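/- Let $d\ge 1$ be an integer, $m\ge 0$, and let $\mathcal M=\mathbb R^d$ or $\mathcal M=\mathbb T^d=(\mathbb R/\mathbb Z)^d$. Let $\widehat{\mathcal M}=\mathbb R^d$ (with Lebesgue measure), respectively $\widehat{\mathcal M}=\mathbb Z^d$ (with counting measure), let $\widehat f$ be the Fourier transform, respectively the sequence of Fourier coefficients, with respect to the characters $e^{2\pi i\xi\cdot x}$, and put $$\|f\|_{H^s}=\big\|(1+|\xi|^2)^{s/2}\widehat f\,\big\|_{L^2(\widehat{\mathcal M})},\qquad \|(f,g)\|_{\mathcal H^s}=\|f\|_{H^s}+\|g\|_{H^{s-1}},\qquad \|f\|_{\mathcal FL^1}=\|\widehat f\,\|_{L^1(\widehat{\mathcal M})}.$$ All functions and distributions are real-valued. Consider the cubic nonlinear wave equation $$\partial_t^2u+(m-\Delta)u+u^3=0\quad\text{on }\mathcal M,\qquad (u,\partial_tu)|_{t=0}=(v_0,v_1).$$ A solution on $[-T,T]$ with data $v_0,v_1\in\mathcal FL^1(\mathcal M)$ is a function $u\in C([-T,T];\mathcal FL^1(\mathcal M))$ satisfying, for all $t\in[-T,T]$, $$u(t)=\cos\!\big(t\sqrt{m-\Delta}\big)v_0+\frac{\sin\!\big(t\sqrt{m-\Delta}\big)}{\sqrt{m-\Delta}}\,v_1-\int_0^t\frac{\sin\!\big((t-\tau)\sqrt{m-\Delta}\big)}{\sqrt{m-\Delta}}\,[u^3(\tau)]\,d\tau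 ,$$ where the operators are Fourier multipliers and the symbol of $\sin(t\sqrt{m-\Delta})/\sqrt{m-\Delta}$ is $t$ where that of $\sqrt{m-\Delta}$ vanishes. **Theorem (norm inflation at general initial data).** Let $s\in\mathbb R$ satisfy either $s\le-\tfrac12$ if $d=1$, or $s<0$ if $d\ge2$. Let $(u_0,u_1)\in H^s(\mathcal M)\times H^{s-1}(\mathcal M)$. Then for every $\varepsilon>0$ there exist $t_\varepsilon\in(0,\varepsilon)$, $T\ge t_\varepsilon$, data $v_0,v_1\in\mathcal FL^1(\mathcal M)$ and a solution $u_\varepsilon\in C([-T,T];\mathcal FL^1(\mathcal M)\cap H^s(\mathcal M))$ with $(u_\varepsilon,\partial_tu_\varepsilon)|_{t=0}=(v_0,v_1)$ such that $$\|(v_0,v_1)-(u_0,u_1)\|_{\mathcal H^s(\mathcal M)}<\varepsilon\qquad\text{but}\qquad\|u_\varepsilon(t_\varepsilon)\|_{H^s(\mathcal M)}>\varepsilon^{-1}.$$ -/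

import Mathlib

open MeasureTheory Set Filter Topology
open scoped SchwartzMap ContDiff ENNReal BoundedContinuousFunction ComplexConjugate

noncomputable section

/-! ### The Fourier side, for a manifold `M` with frequency space `X`

`M` is `ℝ^d` or `𝕋^d = (ℝ/ℤ)^d`, the frequency space `X` is its Pontryagin dual `ℝ^d` or `ℤ^d`
with Lebesgue or counting measure `μ`, `e ξ x = exp (2 π i ξ · x)` are the characters and
`κ ξ = |ξ|` is the Euclidean length, so that `-Δ` has the symbol `(2 π |ξ|) ^ 2`. -/

/-- The function `f` belongs to the Wiener algebra `𝓕L¹(M)` and its Fourier transform is the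
integrable function `F`: `f (x) = ∫ F (ξ) exp (2 π i ξ · x) dξ`. -/
def HasWienerTransform {X M : Type*} [MeasurableSpace X] (μ : Measure X) (e : X → M → ℂ)
    (f : M → ℝ) (F : Lp ℂ 1 μ) : Prop :=
  ∀ x, (f x : ℂ) = ∫ ξ, F ξ * e ξ x ∂μ

/-- The Fourier multiplier with the symbol `a`, applied to the element of the Wiener algebra whose
Fourier transform is `F`. -/
def multiplierApply {X M : Type*} [MeasurableSpace X] (μ : Measure X) (e : X → M → ℂ)
    (a : X → ℝ) (F : Lp ℂ 1 μ) (x : M) : ℂ :=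
  ∫ ξ, (a ξ : ℂ) * F ξ * e ξ x ∂μ

/-- The symbol of `√(m - Δ)` at a frequency of Euclidean length `k`. -/
def kgSymbol (m k : ℝ) : ℝ := √(m + (2 * Real.pi * k) ^ 2)

/-- The symbol of `cos (t √(m - Δ))`. -/
def cosSymbol (m t k : ℝ) : ℝ := Real.cos (t * kgSymbol m k)

/-- The symbol of `sin (t √(m - Δ)) / √(m - Δ)`, with the value `t` where `√(m - Δ)` has the
symbol `0`. -/
def sinSymbol (m t k : ℝ) : ℝ := t * Real.sinc (t * kgSymbol m k)

/-- `u ∈ C([-T, T]; 𝓕L¹(M))` is a real-valued solution of `∂ₜ² u + (m - Δ) u + u³ = 0` with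
`(u, ∂ₜ u) = (v₀, v₁)` at `t = 0`, in the sense of the Duhamel formula
`u (t) = cos (t √(m-Δ)) v₀ + sin (t √(m-Δ)) / √(m-Δ) v₁
  - ∫₀ᵗ sin ((t-τ) √(m-Δ)) / √(m-Δ) [u³ (τ)] dτ`.
Here `U t` and `W t` are the Fourier transforms of `u (t)` and `u (t) ^ 3`. -/
def IsNLWSolution {X M : Type*} [MeasurableSpace X] [TopologicalSpace M] (μ : Measure X)
    (e : X → M → ℂ) (κ : X → ℝ) (m T : ℝ) (v₀ v₁ : M →ᵇ ℝ) (u : ℝ → M →ᵇ ℝ) : Prop :=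
  ∃ (V₀ V₁ : Lp ℂ 1 μ) (U W : ℝ → Lp ℂ 1 μ),
    HasWienerTransform μ e v₀ V₀ ∧ HasWienerTransform μ e v₁ V₁ ∧
    ContinuousOn U (Icc (-T) T) ∧
    ∀ t ∈ Icc (-T) T,
      HasWienerTransform μ e (u t) (U t) ∧
      HasWienerTransform μ e (fun x => u t x ^ 3) (W t) ∧
      ∀ x, (u t x : ℂ) =
        multiplierApply μ e (fun ξ => cosSymbol m t (κ ξ)) V₀ x
          + multiplierApply μ e (fun ξ => sinSymbol m t (κ ξ)) V₁ x
          - ∫ τ in (0 : ℝ)..t,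
              multiplierApply μ e (fun ξ => sinSymbol m (t - τ) (κ ξ)) (W τ) x

/-- `u` is a continuous curve on `[-T, T]` for the extended norm `N`, with finite norm. -/
def ContinuousInNorm {M : Type*} [TopologicalSpace M] (N : (M →ᵇ ℝ) → ℝ≥0∞) (T : ℝ)
    (u : ℝ → M →ᵇ ℝ) : Prop :=
  ∀ t ∈ Icc (-T) T, N (u t) < ⊤ ∧
    Tendsto (fun τ => N (u τ - u t)) (𝓝[Icc (-T) T] t) (𝓝 0)

/-! ### The Euclidean space -/

/-- The characters `exp (2 π i ξ · x)` of `ℝ^d`. -/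
def euclideanChar (d : ℕ) (ξ x : EuclideanSpace ℝ (Fin d)) : ℂ :=
  (Real.fourierChar (inner ℝ ξ x) : ℂ)

/-- The solutions on `ℝ^d`. -/
def IsEuclideanNLWSolution (d : ℕ) (m T : ℝ) (v₀ v₁ : EuclideanSpace ℝ (Fin d) →ᵇ ℝ)
    (u : ℝ → EuclideanSpace ℝ (Fin d) →ᵇ ℝ) : Prop :=
  IsNLWSolution (volume : Measure (EuclideanSpace ℝ (Fin d))) (euclideanChar d)
    (fun ξ => ‖ξ‖) m T v₀ v₁ u

/-- A tempered distribution is real-valued if it commutes with complex conjugation. -/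
def IsRealTempered {d : ℕ} (f : 𝓢'(EuclideanSpace ℝ (Fin d), ℂ)) : Prop :=
  ∀ φ ψ : 𝓢(EuclideanSpace ℝ (Fin d), ℂ), (∀ x, ψ x = conj (φ x)) → f ψ = conj (f φ)

/-- The norm `‖(1 + |ξ|²)^(s/2) 𝓕f‖_{L²}` of `H^s(ℝ^d)`; it is `⊤` if `f ∉ H^s(ℝ^d)`
(the representing `L²` function `g` is unique if it exists). -/
def euclideanSobolevNorm {d : ℕ} (s : ℝ) (f : 𝓢'(EuclideanSpace ℝ (Fin d), ℂ)) : ℝ≥0∞ :=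
  ⨅ (g : Lp ℂ 2 (volume : Measure (EuclideanSpace ℝ (Fin d))))
    (_ : TemperedDistribution.besselPotential (EuclideanSpace ℝ (Fin d)) ℂ s f = g), ‖g‖ₑ

theorem boundedContinuous_memLp_top {d : ℕ} (f : EuclideanSpace ℝ (Fin d) →ᵇ ℝ) :
    MemLp (fun x => (f x : ℂ)) ∞ (volume : Measure (EuclideanSpace ℝ (Fin d))) :=
  (BoundedContinuousFunction.memLp_top f).ofReal

/-- The tempered distribution `φ ↦ ∫ φ f` given by a bounded continuous function `f`. -/
def temperedOfFun {d : ℕ} (f : EuclideanSpace ℝ (Fin d) →ᵇ ℝ) :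
    𝓢'(EuclideanSpace ℝ (Fin d), ℂ) :=
  (boundedContinuous_memLp_top f).toLp (fun x => (f x : ℂ))

/-! ### The torus -/

/-- The Euclidean length of a frequency in `ℤ^d`. -/
def latticeLength {d : ℕ} (n : Fin d → ℤ) : ℝ := √(∑ i, (n i : ℝ) ^ 2)

/-- The solutions on `𝕋^d`. -/
def IsTorusNLWSolution (d : ℕ) (m T : ℝ) (v₀ v₁ : UnitAddTorus (Fin d) →ᵇ ℝ)
    (u : ℝ → UnitAddTorus (Fin d) →ᵇ ℝ) : Prop :=
  IsNLWSolution (Measure.count : Measure (Fin d → ℤ)) (fun n x => UnitAddTorus.mFourier n x)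
    latticeLength m T v₀ v₁ u

/-- The periodic function on `ℝ^d` given by a function on the torus. -/
def torusLift {d : ℕ} (φ : UnitAddTorus (Fin d) → ℂ) (x : EuclideanSpace ℝ (Fin d)) : ℂ :=
  φ (fun i => (x i : UnitAddCircle))

/-- The test functions `C^∞(𝕋^d)`. -/
def TorusTest (d : ℕ) : Submodule ℂ (UnitAddTorus (Fin d) → ℂ) where
  carrier := {φ | ContDiff ℝ ∞ (torusLift φ)}
  add_mem' {φ ψ} hφ hψ := by
    have h₁ : ContDiff ℝ ∞ (torusLift φ) := hφ
    have h₂ : ContDiff ℝ ∞ (torusLift ψ) := hψ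
    exact h₁.add h₂
  zero_mem' := by
    change ContDiff ℝ ∞ fun _ : EuclideanSpace ℝ (Fin d) => (0 : ℂ)
    exact contDiff_const
  smul_mem' c φ hφ := by
    have h : ContDiff ℝ ∞ (torusLift φ) := hφ
    exact h.const_smul c

/-- The distributions on `𝕋^d`: linear functionals on `C^∞(𝕋^d)` that are bounded by finitely many
of the norms of `C^k(𝕋^d)`. -/
structure TorusDistribution (d : ℕ) where
  /-- the functional -/
  toLinearMap : TorusTest d →ₗ[ℂ] ℂ
  /-- its continuity -/
  bound : ∃ (N : ℕ) (C : ℝ), ∀ (φ : TorusTest d) (B : ℝ),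
    (∀ k ≤ N, ∀ x, ‖iteratedFDeriv ℝ k (torusLift (φ : UnitAddTorus (Fin d) → ℂ)) x‖ ≤ B) →
      ‖toLinearMap φ‖ ≤ C * B

theorem mFourier_mem_torusTest {d : ℕ} (n : Fin d → ℤ) :
    (fun x => UnitAddTorus.mFourier n x) ∈ TorusTest d := by
  change ContDiff ℝ ∞ (torusLift fun x => UnitAddTorus.mFourier n x)
  have h : (torusLift fun x => UnitAddTorus.mFourier n x) =
      fun x : EuclideanSpace ℝ (Fin d) =>
        ∏ i, Complex.exp (2 * Real.pi * Complex.I * (n i : ℂ) * ((x i : ℝ) : ℂ)) := by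
    funext x
    simp only [torusLift, UnitAddTorus.mFourier, ContinuousMap.coe_mk]
    refine Finset.prod_congr rfl fun i _ => ?_
    rw [fourier_coe_apply]
    simp
  rw [h]
  have hx : ∀ i : Fin d, ContDiff ℝ ∞ fun x : EuclideanSpace ℝ (Fin d) => ((x i : ℝ) : ℂ) :=
    fun i => Complex.ofRealCLM.contDiff.comp (by fun_prop)
  exact contDiff_prod fun i _ => ((contDiff_const (c := 2 * Real.pi * Complex.I * (n i : ℂ))).mul
    (hx i)).cexp

/-- The Fourier coefficient `⟨f, exp (-2 π i n · x)⟩` of a distribution. -/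
def TorusDistribution.coeff {d : ℕ} (f : TorusDistribution d) (n : Fin d → ℤ) : ℂ :=
  f.toLinearMap ⟨fun x => UnitAddTorus.mFourier (-n) x, mFourier_mem_torusTest (-n)⟩

/-- A distribution on the torus is real-valued if it commutes with complex conjugation. -/
def TorusDistribution.IsReal {d : ℕ} (f : TorusDistribution d) : Prop :=
  ∀ φ ψ : TorusTest d,
    (∀ x, (ψ : UnitAddTorus (Fin d) → ℂ) x = conj ((φ : UnitAddTorus (Fin d) → ℂ) x)) →
      f.toLinearMap ψ = conj (f.toLinearMap φ)

/-- The Fourier coefficients of a function on the torus. -/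
def torusCoeff {d : ℕ} (f : UnitAddTorus (Fin d) →ᵇ ℝ) (n : Fin d → ℤ) : ℂ :=
  UnitAddTorus.mFourierCoeff (fun x => (f x : ℂ)) n

/-- The norm of `H^s(𝕋^d)` in terms of the Fourier coefficients `c`:
`(∑ₙ (1 + |n|²)^s |c n|²)^(1/2)`. -/
def torusSobolevNorm {d : ℕ} (s : ℝ) (c : (Fin d → ℤ) → ℂ) : ℝ≥0∞ :=
  (∑' n, ENNReal.ofReal ((1 + latticeLength n ^ 2) ^ s * ‖c n‖ ^ 2)) ^ (1 / 2 : ℝ)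

end

/-! The mechanism is a high-to-low frequency cascade, run on the Fourier side in the convolution
algebra L¹. The Fourier transforms of the given data are first replaced by bounded integrable
functions `F₀`, `F₁`, close to them in the Sobolev norms. To `F₀` is added a multiple `R` of four
bumps of radius 1/12 at the frequencies ±Nθ and ±2Nθ, where θ is a unit vector. Write A = 4 R `vol`,
which bounds the L¹ norm of this wave for every N. For fixed R and s < 0 the wave tends to zero in
H^s as N → ∞, so the perturbed data stay close to the given ones.

A contraction argument in L¹ gives a solution up to a time t comparable to 1/A. The resonances N + N
− 2N = 0 and −N − N + 2N = 0 make the cube of the free wave deposit mass near frequency zero, where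
the propagator of velocity is nearly multiplication by t − τ. The time factor cos²(τw) cos(2τw), w =
2πN, has mean 1/4, and its Duhamel integral is at least t²/8 for every w ≠ 0. The low frequency
output is therefore of order A³t², that is, of order A. The corrections are a smaller multiple of A
plus a quantity independent of A and N. Low frequencies control the H^s norm from below, so taking A
large and afterwards N large gives the inflation.

The core is `norm_lowFreq_solution_ge`, resting on `lowFreq_cube_wave` and
`integral_sub_mul_cos_sq_mul_cos`; `exists_norm_inflation` chooses the parameters. All of this uses
only a subadditive even length and a unit vector, so ℝ^d and 𝕋^d are treated together. What remains
is to match the Sobolev norms and the reality of distributions with weighted L² norms and Hermitian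
symmetry of their transforms. -/

noncomputable section

namespace Wiener

/-! ### Bounded multipliers and convolution on L¹. -/

section

section Multiplier

variable {X : Type*} [MeasurableSpace X] {μ : Measure X}

theorem integrable_coe (F : Lp ℂ 1 μ) : Integrable F μ := L1.integrable_coeFn F

theorem integrable_bdd_mul {ψ : X → ℂ} (hψ : Measurable ψ) {c : ℝ} (hc : ∀ x, ‖ψ x‖ ≤ c)
    (F : Lp ℂ 1 μ) : Integrable (fun x => ψ x * F x) μ :=
  (integrable_coe F).bdd_mul hψ.aestronglyMeasurable (Eventually.of_forall hc)

/-- Integration against a bounded measurable function, as a functional on `L¹`. -/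
def pairing (μ : Measure X) (ψ : X → ℂ) (hψ : Measurable ψ) (c : ℝ) (hc : ∀ x, ‖ψ x‖ ≤ c) :
    Lp ℂ 1 μ →L[ℂ] ℂ :=
  LinearMap.mkContinuous
    { toFun := fun F => ∫ x, ψ x * F x ∂μ
      map_add' := fun F G => by
        rw [← integral_add (integrable_bdd_mul hψ hc F) (integrable_bdd_mul hψ hc G)]
        refine integral_congr_ae ?_
        filter_upwards [Lp.coeFn_add F G] with x hx
        rw [hx, Pi.add_apply, mul_add]
      map_smul' := fun a F => by
        rw [RingHom.id_apply, smul_eq_mul, ← integral_const_mul]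
        refine integral_congr_ae ?_
        filter_upwards [Lp.coeFn_smul a F] with x hx
        rw [hx, Pi.smul_apply, smul_eq_mul]
        ring } c
    (fun F => by
      change ‖∫ x, ψ x * F x ∂μ‖ ≤ c * ‖F‖
      rw [L1.norm_eq_integral_norm, ← integral_const_mul]
      refine norm_integral_le_of_norm_le ((integrable_coe F).norm.const_mul c)
        (Eventually.of_forall fun x => ?_)
      rw [norm_mul]
      exact mul_le_mul_of_nonneg_right (hc x) (norm_nonneg _))

theorem pairing_apply {ψ : X → ℂ} {hψ : Measurable ψ} {c : ℝ} {hc : ∀ x, ‖ψ x‖ ≤ c}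
    (F : Lp ℂ 1 μ) : pairing μ ψ hψ c hc F = ∫ x, ψ x * F x ∂μ := rfl

theorem norm_pairing_le {ψ : X → ℂ} {hψ : Measurable ψ} {c : ℝ} {hc : ∀ x, ‖ψ x‖ ≤ c}
    (F : Lp ℂ 1 μ) : ‖pairing μ ψ hψ c hc F‖ ≤ c * ‖F‖ := by
  rw [pairing_apply, L1.norm_eq_integral_norm, ← integral_const_mul]
  refine norm_integral_le_of_norm_le ((integrable_coe F).norm.const_mul c)
    (Eventually.of_forall fun x => ?_)
  rw [norm_mul]
  exact mul_le_mul_of_nonneg_right (hc x) (norm_nonneg _)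

/-- Multiplication by a bounded measurable real function on `L¹`. -/
def mulOp (μ : Measure X) (a : X → ℝ) (ha : Measurable a) (c : ℝ) (hc : ∀ x, |a x| ≤ c) :
    Lp ℂ 1 μ →L[ℂ] Lp ℂ 1 μ :=
  have hm : Measurable fun x => (a x : ℂ) := Complex.measurable_ofReal.comp ha
  have hc' : ∀ x, ‖(a x : ℂ)‖ ≤ c := fun x => by simpa using hc x
  LinearMap.mkContinuous
    { toFun := fun F => (integrable_bdd_mul hm hc' F).toL1 _
      map_add' := fun F G => by
        rw [← Integrable.toL1_add, Integrable.toL1_eq_toL1_iff]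
        filter_upwards [Lp.coeFn_add F G] with x hx
        rw [hx, Pi.add_apply, Pi.add_apply, mul_add]
      map_smul' := fun b F => by
        rw [RingHom.id_apply, ← Integrable.toL1_smul', Integrable.toL1_eq_toL1_iff]
        filter_upwards [Lp.coeFn_smul b F] with x hx
        rw [hx, Pi.smul_apply, Pi.smul_apply, smul_eq_mul, smul_eq_mul]
        ring } c
    (fun F => by
      change ‖(integrable_bdd_mul hm hc' F).toL1 _‖ ≤ c * ‖F‖
      rw [L1.norm_eq_integral_norm, L1.norm_eq_integral_norm, ← integral_const_mul]
      refine integral_mono_ae (integrable_coe _).norm ((integrable_coe F).norm.const_mul c) ?_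
      filter_upwards [Integrable.coeFn_toL1 (integrable_bdd_mul hm hc' F)] with x hx
      rw [hx, norm_mul]
      exact mul_le_mul_of_nonneg_right (hc' x) (norm_nonneg _))

variable {a b : X → ℝ} {ha : Measurable a} {hb : Measurable b} {c c' : ℝ}
  {hc : ∀ x, |a x| ≤ c} {hc' : ∀ x, |b x| ≤ c'}

theorem coe_mulOp (F : Lp ℂ 1 μ) : mulOp μ a ha c hc F =ᵐ[μ] fun x => (a x : ℂ) * F x := by
  have hm : Measurable fun x => (a x : ℂ) := Complex.measurable_ofReal.comp ha
  exact Integrable.coeFn_toL1 (integrable_bdd_mul hm (c := c) (fun x => by simpa using hc x) F)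

theorem norm_le_of_ae_le {F G : Lp ℂ 1 μ} {k : ℝ} (h : ∀ᵐ x ∂μ, ‖F x‖ ≤ k * ‖G x‖) :
    ‖F‖ ≤ k * ‖G‖ := by
  rw [L1.norm_eq_integral_norm, L1.norm_eq_integral_norm, ← integral_const_mul]
  exact integral_mono_ae (integrable_coe _).norm ((integrable_coe G).norm.const_mul k) h

theorem norm_mulOp_apply_le {k : ℝ} (hk : ∀ x, |a x| ≤ k) (F : Lp ℂ 1 μ) :
    ‖mulOp μ a ha c hc F‖ ≤ k * ‖F‖ := by
  refine norm_le_of_ae_le ?_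
  filter_upwards [coe_mulOp (ha := ha) (hc := hc) F] with x hx
  rw [hx, norm_mul, Complex.norm_real]
  exact mul_le_mul_of_nonneg_right (hk x) (norm_nonneg _)

theorem norm_mulOp_sub_le {k : ℝ} (hk : ∀ x, |a x - b x| ≤ k) (F : Lp ℂ 1 μ) :
    ‖mulOp μ a ha c hc F - mulOp μ b hb c' hc' F‖ ≤ k * ‖F‖ := by
  refine norm_le_of_ae_le ?_
  filter_upwards [coe_mulOp (ha := ha) (hc := hc) F, coe_mulOp (ha := hb) (hc := hc') F,
    Lp.coeFn_sub (mulOp μ a ha c hc F) (mulOp μ b hb c' hc' F)] with x hx hx' hs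
  rw [hs, Pi.sub_apply, hx, hx', ← sub_mul, norm_mul, ← Complex.ofReal_sub, Complex.norm_real]
  exact mul_le_mul_of_nonneg_right (hk x) (norm_nonneg _)

end Multiplier

section Hermitian

variable {X : Type*} [AddCommGroup X] [MeasurableSpace X] [MeasurableNeg X] {μ : Measure X}

/-- The Fourier transforms of real functions. -/
def IsHermitian (F : Lp ℂ 1 μ) : Prop := ∀ᵐ x ∂μ, F (-x) = conj (F x)

theorem IsHermitian.mulOp [μ.IsNegInvariant] {F : Lp ℂ 1 μ} (hF : IsHermitian F) {a : X → ℝ}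
    {ha : Measurable a}
    {c : ℝ} {hc : ∀ x, |a x| ≤ c} (heven : ∀ x, a (-x) = a x) :
    IsHermitian (mulOp μ a ha c hc F) := by
  have h := coe_mulOp (ha := ha) (hc := hc) F
  have h' := (Measure.measurePreserving_neg μ).quasiMeasurePreserving.ae h
  filter_upwards [h, h', hF] with x hx hx' hFx
  rw [hx, hx', hFx, heven, map_mul, Complex.conj_ofReal]

end Hermitian

section Convolution

variable {X : Type*} [AddCommGroup X] [MeasurableSpace X] [MeasurableAdd₂ X] [MeasurableNeg X]
  {μ : Measure X} [μ.IsAddLeftInvariant]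

theorem ae_sub_left {p : X → Prop} (h : ∀ᵐ x ∂μ, p x) [μ.IsNegInvariant] (x : X) :
    ∀ᵐ t ∂μ, p (x - t) :=
  (μ.measurePreserving_sub_left x).quasiMeasurePreserving.ae h

variable [SFinite μ]

theorem integrable_convolution_integrand (F G : Lp ℂ 1 μ) :
    Integrable (fun p : X × X => F p.2 * G (p.1 - p.2)) (μ.prod μ) :=
  Integrable.convolution_integrand (ContinuousLinearMap.mul ℂ ℂ) (integrable_coe F)
    (integrable_coe G)

theorem integrable_convolution (F G : Lp ℂ 1 μ) :
    Integrable (fun x => ∫ t, F t * G (x - t) ∂μ) μ :=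
  (integrable_convolution_integrand F G).integral_prod_left

theorem norm_convolution_le (F G : Lp ℂ 1 μ) :
    ‖(integrable_convolution F G).toL1 _‖ ≤ ‖F‖ * ‖G‖ := by
  have hi := (integrable_convolution_integrand F G).norm
  calc ‖(integrable_convolution F G).toL1 _‖
      = ∫ x, ‖∫ t, F t * G (x - t) ∂μ‖ ∂μ := L1.norm_of_fun_eq_integral_norm _
    _ ≤ ∫ x, ∫ t, ‖F t * G (x - t)‖ ∂μ ∂μ :=
        integral_mono (integrable_convolution F G).norm hi.integral_prod_left
          fun x => norm_integral_le_integral_norm _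
    _ = ∫ t, ∫ x, ‖F t * G (x - t)‖ ∂μ ∂μ := integral_integral_swap hi
    _ = ∫ t, ‖F t‖ * ‖G‖ ∂μ := by
        congr 1
        funext t
        simp_rw [norm_mul]
        rw [integral_const_mul, L1.norm_eq_integral_norm G]
        congr 1
        exact integral_sub_right_eq_self (fun x => ‖G x‖) t
    _ = ‖F‖ * ‖G‖ := by rw [integral_mul_const, L1.norm_eq_integral_norm F]

theorem ae_integrable_convolution (F G : Lp ℂ 1 μ) :
    ∀ᵐ x ∂μ, Integrable (fun t => F t * G (x - t)) μ :=
  (integrable_convolution_integrand F G).prod_right_ae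

variable [μ.IsNegInvariant]

/-- Convolution on `L¹`, as a continuous bilinear map. -/
def conv (μ : Measure X) [SFinite μ] [μ.IsAddLeftInvariant] [μ.IsNegInvariant] :
    Lp ℂ 1 μ →L[ℂ] Lp ℂ 1 μ →L[ℂ] Lp ℂ 1 μ :=
  LinearMap.mkContinuous₂
    (LinearMap.mk₂ ℂ (fun F G : Lp ℂ 1 μ => (integrable_convolution F G).toL1 _)
      (fun F F' G => by
        rw [← Integrable.toL1_add, Integrable.toL1_eq_toL1_iff]
        filter_upwards [ae_integrable_convolution F G, ae_integrable_convolution F' G]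
          with x hx hx'
        rw [Pi.add_apply, ← integral_add hx hx']
        refine integral_congr_ae ?_
        filter_upwards [Lp.coeFn_add F F'] with t ht
        rw [ht, Pi.add_apply, add_mul])
      (fun a F G => by
        rw [← Integrable.toL1_smul', Integrable.toL1_eq_toL1_iff]
        refine Eventually.of_forall fun x => ?_
        rw [Pi.smul_apply, smul_eq_mul]
        dsimp only
        rw [← integral_const_mul]
        refine integral_congr_ae ?_
        filter_upwards [Lp.coeFn_smul a F] with t ht
        rw [ht, Pi.smul_apply, smul_eq_mul, mul_assoc])
      (fun F G G' => by
        rw [← Integrable.toL1_add, Integrable.toL1_eq_toL1_iff]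
        filter_upwards [ae_integrable_convolution F G, ae_integrable_convolution F G']
          with x hx hx'
        rw [Pi.add_apply, ← integral_add hx hx']
        refine integral_congr_ae ?_
        filter_upwards [ae_sub_left (Lp.coeFn_add G G') x] with t ht
        rw [ht, Pi.add_apply, mul_add])
      (fun a F G => by
        rw [← Integrable.toL1_smul', Integrable.toL1_eq_toL1_iff]
        refine Eventually.of_forall fun x => ?_
        rw [Pi.smul_apply, smul_eq_mul]
        dsimp only
        rw [← integral_const_mul]
        refine integral_congr_ae ?_
        filter_upwards [ae_sub_left (Lp.coeFn_smul a G) x] with t ht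
        rw [ht, Pi.smul_apply, smul_eq_mul, mul_left_comm]))
    1 fun F G => by
      rw [one_mul]
      exact norm_convolution_le F G

theorem norm_conv_le (F G : Lp ℂ 1 μ) : ‖conv μ F G‖ ≤ ‖F‖ * ‖G‖ :=
  norm_convolution_le F G

theorem coe_conv (F G : Lp ℂ 1 μ) : conv μ F G =ᵐ[μ] fun x => ∫ t, F t * G (x - t) ∂μ :=
  Integrable.coeFn_toL1 (integrable_convolution F G)

/-- Fubini and the substitution x = t + y. With ψ a character this gives multiplicativity of
evaluation at a point; with ψ the indicator of a ball it computes the low frequencies of a product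
of bumps. -/
theorem integral_mul_conv {ψ : X → ℂ} (hψ : Measurable ψ) {c : ℝ} (hc : ∀ x, ‖ψ x‖ ≤ c)
    (F G : Lp ℂ 1 μ) :
    ∫ x, ψ x * conv μ F G x ∂μ = ∫ t, F t * ∫ y, ψ (t + y) * G y ∂μ ∂μ := by
  have hi : Integrable (fun p : X × X => ψ p.1 * (F p.2 * G (p.1 - p.2))) (μ.prod μ) :=
    (integrable_convolution_integrand F G).bdd_mul
      (hψ.comp measurable_fst).aestronglyMeasurable (Eventually.of_forall fun p => hc p.1)
  calc ∫ x, ψ x * conv μ F G x ∂μ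
      = ∫ x, ∫ t, ψ x * (F t * G (x - t)) ∂μ ∂μ := by
        refine integral_congr_ae ?_
        filter_upwards [coe_conv F G] with x hx
        rw [hx, integral_const_mul]
    _ = ∫ t, ∫ x, ψ x * (F t * G (x - t)) ∂μ ∂μ := integral_integral_swap hi
    _ = ∫ t, F t * ∫ y, ψ (t + y) * G y ∂μ ∂μ := by
        congr 1
        funext t
        rw [← integral_const_mul]
        rw [← integral_sub_right_eq_self (fun y => F t * (ψ (t + y) * G y)) t]
        congr 1
        funext x
        rw [add_sub_cancel]
        ring

/-- Young's inequality L¹ ∗ L^∞ ⊂ L^∞. It propagates a sup bound on the Fourier transform through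
the nonlinearity, which later places the solution in H^s. -/
theorem norm_conv_apply_le {F G : Lp ℂ 1 μ} {D : ℝ} (hG : ∀ᵐ x ∂μ, ‖G x‖ ≤ D) :
    ∀ᵐ x ∂μ, ‖conv μ F G x‖ ≤ ‖F‖ * D := by
  filter_upwards [coe_conv F G] with x hx
  rw [hx, L1.norm_eq_integral_norm, ← integral_mul_const]
  refine norm_integral_le_of_norm_le ((integrable_coe F).norm.mul_const D) ?_
  filter_upwards [ae_sub_left hG x] with t ht
  rw [norm_mul]
  exact mul_le_mul_of_nonneg_left ht (norm_nonneg _)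

/-- The cube of an element of the convolution algebra `L¹`. -/
def cube (U : Lp ℂ 1 μ) : Lp ℂ 1 μ := conv μ U (conv μ U U)

theorem norm_conv_conv_le (F G H : Lp ℂ 1 μ) : ‖conv μ F (conv μ G H)‖ ≤ ‖F‖ * (‖G‖ * ‖H‖) :=
  (norm_conv_le _ _).trans (mul_le_mul_of_nonneg_left (norm_conv_le _ _) (norm_nonneg _))

theorem norm_cube_le {U : Lp ℂ 1 μ} {r : ℝ} (hr : ‖U‖ ≤ r) : ‖cube U‖ ≤ r ^ 3 := by
  refine (norm_conv_conv_le U U U).trans ?_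
  have : ‖U‖ * (‖U‖ * ‖U‖) = ‖U‖ ^ 3 := by ring
  rw [this]
  gcongr

theorem norm_cube_sub_le {U V : Lp ℂ 1 μ} {r : ℝ} (hU : ‖U‖ ≤ r) (hV : ‖V‖ ≤ r) :
    ‖cube U - cube V‖ ≤ 3 * r ^ 2 * ‖U - V‖ := by
  have hr : 0 ≤ r := (norm_nonneg _).trans hU
  -- The difference of cubes telescopes, replacing one factor at a time.
  have h : cube U - cube V = conv μ (U - V) (conv μ U U) + conv μ V (conv μ (U - V) U)
      + conv μ V (conv μ V (U - V)) := by
    simp only [cube, map_sub, sub_apply]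
    abel
  rw [h]
  have h1 := norm_conv_conv_le (U - V) U U
  have h2 := norm_conv_conv_le V (U - V) U
  have h3 := norm_conv_conv_le V V (U - V)
  have e1 : ‖U - V‖ * (‖U‖ * ‖U‖) ≤ ‖U - V‖ * (r * r) := by gcongr
  have e2 : ‖V‖ * (‖U - V‖ * ‖U‖) ≤ r * (‖U - V‖ * r) := by gcongr
  have e3 : ‖V‖ * (‖V‖ * ‖U - V‖) ≤ r * (r * ‖U - V‖) := by gcongr
  refine (norm_add₃_le).trans ?_
  linarith

theorem norm_cube_apply_le {U : Lp ℂ 1 μ} {r D : ℝ} (hr : ‖U‖ ≤ r) (hU : ∀ᵐ x ∂μ, ‖U x‖ ≤ D) :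
    ∀ᵐ x ∂μ, ‖cube U x‖ ≤ r ^ 2 * D := by
  filter_upwards [norm_conv_apply_le (F := U) (norm_conv_apply_le (F := U) hU),
    hU] with x hx hD
  refine hx.trans ?_
  have hD0 : 0 ≤ D := (norm_nonneg _).trans hD
  have : ‖U‖ * (‖U‖ * D) = ‖U‖ ^ 2 * D := by ring
  rw [this]
  gcongr

theorem IsHermitian.conv {F G : Lp ℂ 1 μ} (hF : IsHermitian F) (hG : IsHermitian G) :
    IsHermitian (conv μ F G) := by
  have h := coe_conv F G
  have h' := (Measure.measurePreserving_neg μ).quasiMeasurePreserving.ae h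
  filter_upwards [h, h'] with x hx hx'
  rw [hx, hx', ← integral_conj, ← integral_neg_eq_self]
  refine integral_congr_ae ?_
  filter_upwards [hF, ae_sub_left hG x] with t ht ht'
  have e : -x - -t = -(x - t) := by abel
  rw [ht, e, ht', map_mul]

theorem IsHermitian.cube {F : Lp ℂ 1 μ} (hF : IsHermitian F) : IsHermitian (cube F) :=
  hF.conv (hF.conv hF)

end Convolution

end

/-! ### Volterra equations with a cubic nonlinearity. -/

section

section Duhamel

variable {A : Type*} [NormedAddCommGroup A] [NormedSpace ℂ A]

/-- The Duhamel integral `∫₀ᵗ K (t - τ) G (τ) dτ`. -/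
def duhamel (K : ℝ → A →L[ℂ] A) (G : ℝ → A) (t : ℝ) : A := ∫ τ in (0 : ℝ)..t, K (t - τ) (G τ)

variable {K : ℝ → A →L[ℂ] A}

theorem continuous_duhamel_integrand (hK : Continuous K) {G : ℝ → A} (hG : Continuous G) (t : ℝ) :
    Continuous fun τ => K (t - τ) (G τ) :=
  (hK.comp (continuous_const.sub continuous_id)).clm_apply hG

theorem continuous_duhamel (hK : Continuous K) {G : ℝ → A} (hG : Continuous G) :
    Continuous (duhamel K G) := by
  refine intervalIntegral.continuous_parametric_intervalIntegral_of_continuous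
    (f := fun t τ => K (t - τ) (G τ)) ?_ continuous_id
  exact (hK.comp (continuous_fst.sub continuous_snd)).clm_apply (hG.comp continuous_snd)

theorem abs_sub_le_of_mem_uIoc {t τ T : ℝ} (hτ : τ ∈ Set.uIoc 0 t) (ht : t ∈ Icc (-T) T) :
    |t - τ| ≤ T ∧ τ ∈ Icc (-T) T := by
  obtain ⟨h1, h2⟩ := ht
  rcases le_total 0 t with h | h
  · rw [Set.uIoc_of_le h] at hτ
    obtain ⟨h3, h4⟩ := hτ
    exact ⟨abs_le.2 ⟨by linarith, by linarith⟩, by linarith, by linarith⟩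
  · rw [Set.uIoc_of_ge h] at hτ
    obtain ⟨h3, h4⟩ := hτ
    exact ⟨abs_le.2 ⟨by linarith, by linarith⟩, by linarith, by linarith⟩

theorem norm_duhamel_le (hK' : ∀ t, ‖K t‖ ≤ |t|) {G : ℝ → A} {T c t : ℝ} (ht : t ∈ Icc (-T) T)
    (hG : ∀ τ ∈ Icc (-T) T, ‖G τ‖ ≤ c) : ‖duhamel K G t‖ ≤ T ^ 2 * c := by
  have hT : 0 ≤ T := by linarith [ht.1, ht.2]
  have hc : 0 ≤ c := (norm_nonneg _).trans (hG t ht)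
  refine (intervalIntegral.norm_integral_le_of_norm_le_const (C := T * c) fun τ hτ => ?_).trans ?_
  · obtain ⟨h1, h2⟩ := abs_sub_le_of_mem_uIoc hτ ht
    refine ((K (t - τ)).le_opNorm _).trans ?_
    exact mul_le_mul ((hK' _).trans h1) (hG τ h2) (norm_nonneg _) hT
  · have : |t - 0| ≤ T := by rw [sub_zero]; exact abs_le.2 ht
    calc T * c * |t - 0| ≤ T * c * T := by gcongr
      _ = T ^ 2 * c := by ring

theorem duhamel_sub (hK : Continuous K) {G H : ℝ → A} (hG : Continuous G) (hH : Continuous H)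
    (t : ℝ) : duhamel K G t - duhamel K H t = duhamel K (fun τ => G τ - H τ) t := by
  rw [duhamel, duhamel, duhamel, ← intervalIntegral.integral_sub
    ((continuous_duhamel_integrand hK hG t).intervalIntegrable _ _)
    ((continuous_duhamel_integrand hK hH t).intervalIntegrable _ _)]
  simp only [map_sub]

theorem map_duhamel [CompleteSpace A] (hK : Continuous K) {G : ℝ → A} (hG : Continuous G)
    (ℓ : A →L[ℂ] ℂ) (t : ℝ) :
    ℓ (duhamel K G t) = ∫ τ in (0 : ℝ)..t, ℓ (K (t - τ) (G τ)) :=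
  (ℓ.intervalIntegral_comp_comm
    ((continuous_duhamel_integrand hK hG t).intervalIntegrable _ _)).symm

/-- The solution of a Volterra equation with a locally Lipschitz cubic nonlinearity, with values in
an invariant closed set. -/
theorem exists_volterra_solution [CompleteSpace A] {C : A → A}
    (hC0 : ∀ r : ℝ, ∀ U : A, ‖U‖ ≤ r → ‖C U‖ ≤ r ^ 3)
    (hC : ∀ r : ℝ, ∀ U V : A, ‖U‖ ≤ r → ‖V‖ ≤ r → ‖C U - C V‖ ≤ 3 * r ^ 2 * ‖U - V‖)
    (hCc : Continuous C)
    (hK : Continuous K) (hK' : ∀ t, ‖K t‖ ≤ |t|) {L : ℝ → A} (hL : Continuous L) {B T : ℝ}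
    (hT : 0 < T) (hB0 : 0 ≤ B) (hB : ∀ t ∈ Icc (-T) T, ‖L t‖ ≤ B) (hTB : 24 * T ^ 2 * B ^ 2 ≤ 1)
    {Z : Set A} (hZc : IsClosed Z) (hZ0 : (0 : A) ∈ Z)
    (hZ : ∀ U : ℝ → A, Continuous U → (∀ t, U t ∈ Z ∧ ‖U t‖ ≤ 2 * B) →
      ∀ t ∈ Icc (-T) T, L t - duhamel K (fun τ => C (U τ)) t ∈ Z) :
    ∃ U : ℝ → A, Continuous U ∧ (∀ t, U t ∈ Z ∧ ‖U t‖ ≤ 2 * B) ∧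
      ∀ t ∈ Icc (-T) T, U t = L t - duhamel K (fun τ => C (U τ)) t := by
  classical
  -- Clamping time to [-T, T] lets the fixed point problem live on bounded continuous functions on
  -- all of ℝ, with the equation imposed only on the interval.
  set p : ℝ → ℝ := fun t => max (-T) (min T t) with hp
  have hpc : Continuous p := by fun_prop
  have hpm : ∀ t, p t ∈ Icc (-T) T := fun t =>
    ⟨le_max_left _ _, max_le (by linarith) (min_le_left _ _)⟩
  have hpe : ∀ t ∈ Icc (-T) T, p t = t := fun t ht => by
    rw [hp]
    dsimp only
    rw [min_eq_right ht.2, max_eq_right ht.1]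
  let s : Set (ℝ →ᵇ A) := {U | ∀ t, U t ∈ Z ∧ ‖U t‖ ≤ 2 * B}
  have hsc : IsClosed s := by
    have : s = ⋂ t : ℝ, (fun U : ℝ →ᵇ A => U t) ⁻¹' (Z ∩ Metric.closedBall 0 (2 * B)) := by
      ext U
      simp [s]
    rw [this]
    exact isClosed_iInter fun t => (hZc.inter Metric.isClosed_closedBall).preimage
      (continuous_eval_const t)
  have hstep : ∀ U ∈ s, ∀ t ∈ Icc (-T) T,
      ‖L t - duhamel K (fun τ => C (U τ)) t‖ ≤ 2 * B := by
    intro U hU t ht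
    have h1 := norm_duhamel_le (K := K) hK' ht
      (G := fun τ => C (U τ)) (c := (2 * B) ^ 3) fun τ _ => hC0 _ _ (hU τ).2
    have h2 : T ^ 2 * (2 * B) ^ 3 ≤ B := by
      have : 24 * T ^ 2 * B ^ 2 * B ≤ 1 * B := mul_le_mul_of_nonneg_right hTB hB0
      nlinarith
    exact (norm_sub_le _ _).trans (by linarith [hB t ht])
  have hcont : ∀ U : ℝ →ᵇ A, Continuous fun t =>
      L (p t) - duhamel K (fun τ => C (U τ)) (p t) := fun U =>
    (hL.comp hpc).sub ((continuous_duhamel hK (hCc.comp U.continuous)).comp hpc)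
  -- The uniform bound needed to form a bounded continuous function holds only on `s`; the value
  -- outside `s` is irrelevant.
  let Φ : (ℝ →ᵇ A) → (ℝ →ᵇ A) := fun U =>
    if hU : U ∈ s then BoundedContinuousFunction.ofNormedAddCommGroup _ (hcont U) (2 * B)
      (fun t => hstep U hU _ (hpm t)) else U
  have hΦ : ∀ U ∈ s, ∀ t, Φ U t = L (p t) - duhamel K (fun τ => C (U τ)) (p t) := by
    intro U hU t
    simp only [Φ, hU, dif_pos]
    rfl
  have hmaps : MapsTo Φ s s := by
    intro U hU t
    rw [hΦ U hU]
    exact ⟨hZ U U.continuous hU _ (hpm t), hstep U hU _ (hpm t)⟩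
  have hcontr : ContractingWith (1 / 2) (hmaps.restrict Φ s s) := by
    refine ⟨by norm_num, LipschitzWith.of_dist_le_mul fun U V => ?_⟩
    obtain ⟨U, hU⟩ := U
    obtain ⟨V, hV⟩ := V
    change dist (Φ U) (Φ V) ≤ _ * dist U V
    refine (BoundedContinuousFunction.dist_le (by positivity)).2 fun t => ?_
    rw [hΦ U hU, hΦ V hV, dist_eq_norm, sub_sub_sub_cancel_left,
      duhamel_sub hK (G := fun τ => C (V τ)) (H := fun τ => C (U τ))
        (hCc.comp V.continuous) (hCc.comp U.continuous)]
    -- The Lipschitz constant is T² · 3(2B)² = 12 T²B², so the smallness condition 24 T²B² ≤ 1 is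
    -- exactly what makes it at most 1/2.
    refine (norm_duhamel_le (K := K) hK' (hpm t) (c := 3 * (2 * B) ^ 2 * dist U V)
      fun τ _ => ?_).trans ?_
    · refine (hC _ _ _ (hV τ).2 (hU τ).2).trans ?_
      gcongr
      rw [← dist_eq_norm, dist_comm]
      exact BoundedContinuousFunction.dist_coe_le_dist τ
    · have : 24 * T ^ 2 * B ^ 2 * dist U V ≤ 1 * dist U V :=
        mul_le_mul_of_nonneg_right hTB dist_nonneg
      push_cast
      nlinarith
  have h0 : (0 : ℝ →ᵇ A) ∈ s := fun t => by
    simpa using ⟨hZ0, hB0⟩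
  obtain ⟨U, hU, hfix, -⟩ := hcontr.exists_fixedPoint' hsc.isComplete hmaps h0 (edist_ne_top _ _)
  refine ⟨U, U.continuous, hU, fun t ht => ?_⟩
  have := hΦ U hU t
  rwa [hfix, hpe t ht] at this

end Duhamel

section Invariance

variable {A : Type*} [NormedAddCommGroup A] [NormedSpace ℝ A] [CompleteSpace A]

/-- The integral is the average of t • f over the interval, and averages stay in closed convex sets.
Scaling by t also covers negative times. -/
theorem intervalIntegral_mem_of_convex {s : Set A} (hs : Convex ℝ s) (hsc : IsClosed s)
    {f : ℝ → A} (hf : Continuous f) {t : ℝ} (ht : t ≠ 0)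
    (h : ∀ τ ∈ Set.uIoc 0 t, t • f τ ∈ s) : ∫ τ in (0 : ℝ)..t, f τ ∈ s := by
  have hmem := hs.set_average_mem (μ := volume) (t := Set.uIoc 0 t) (f := fun τ => t • f τ) hsc
    (by simpa [Real.volume_uIoc] using ht)
    (by simp [Real.volume_uIoc])
    ((ae_restrict_iff' measurableSet_uIoc).2 (Eventually.of_forall h))
    (((hf.const_smul t).integrableOn_uIcc (a := 0) (b := t)).mono_set Set.uIoc_subset_uIcc)
  rw [interval_average_eq, intervalIntegral.integral_smul, smul_smul, sub_zero,
    inv_mul_cancel₀ ht, one_smul] at hmem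
  exact hmem

end Invariance

end

/-! ### The linear propagators, and local solutions with bounded Hermitian transform. -/

section

theorem kgSymbol_nonneg (m k : ℝ) : 0 ≤ kgSymbol m k := Real.sqrt_nonneg _

theorem abs_cosSymbol_le (m t k : ℝ) : |cosSymbol m t k| ≤ 1 := Real.abs_cos_le_one _

theorem abs_sinSymbol_le (m t k : ℝ) : |sinSymbol m t k| ≤ |t| := by
  rw [sinSymbol, abs_mul]
  exact mul_le_of_le_one_right (abs_nonneg _) (Real.abs_sinc_le_one _)

theorem mul_sinc_mul {t w : ℝ} (hw : w ≠ 0) : t * Real.sinc (t * w) = Real.sin (t * w) / w := by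
  rcases eq_or_ne t 0 with rfl | ht
  · simp
  · rw [Real.sinc_of_ne_zero (mul_ne_zero ht hw)]
    field_simp

/-- The division by √(m − Δ) compensates the frequency factor from differentiating in time, so the
bound is uniform in k. This yields continuity of `sinOp` in operator norm. -/
theorem abs_sinSymbol_sub_le (m t t' k : ℝ) :
    |sinSymbol m t k - sinSymbol m t' k| ≤ |t - t'| := by
  unfold sinSymbol
  rcases (kgSymbol_nonneg m k).eq_or_lt with h | h
  · simp [← h]
  · rw [mul_sinc_mul h.ne', mul_sinc_mul h.ne', ← sub_div, abs_div, abs_of_pos h, div_le_iff₀ h]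
    refine (Real.abs_sin_sub_sin_le _ _).trans_eq ?_
    rw [← sub_mul, abs_mul, abs_of_pos h]

theorem abs_sinc_sub_one_le (x : ℝ) : |Real.sinc x - 1| ≤ 2 * |x| := by
  rcases le_total 1 |x| with h | h
  · have := abs_le.1 (Real.abs_sinc_le_one x)
    rw [abs_le]
    constructor <;> linarith
  · rcases eq_or_ne x 0 with rfl | hx
    · simp
    · have hx' : 0 < |x| := abs_pos.2 hx
      have h1 := Real.sin_bound h
      have h2 : |Real.sin x - x| ≤ |x| ^ 3 / 6 + |x| ^ 5 / 100 := by
        have : Real.sin x - x = (Real.sin x - (x - x ^ 3 / 6)) + -(x ^ 3 / 6) := by ring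
        rw [this]
        refine (abs_add_le _ _).trans ?_
        rw [abs_neg, abs_div, abs_pow, abs_of_pos (by norm_num : (0 : ℝ) < 6)]
        linarith
      have h3 : Real.sinc x - 1 = (Real.sin x - x) / x := by
        rw [Real.sinc_of_ne_zero hx]
        field_simp
      rw [h3, abs_div, div_le_iff₀ hx']
      have h4 : |x| ^ 3 ≤ |x| ^ 2 := pow_le_pow_of_le_one hx'.le h (by norm_num)
      have h5 : |x| ^ 5 ≤ |x| ^ 2 := pow_le_pow_of_le_one hx'.le h (by norm_num)
      nlinarith [sq_nonneg |x|]

/-- At bounded frequency and short time the velocity propagator is multiplication by t up to O(t²).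
-/
theorem abs_sinSymbol_sub_self_le (m t k : ℝ) :
    |sinSymbol m t k - t| ≤ 2 * t ^ 2 * kgSymbol m k := by
  have : sinSymbol m t k - t = t * (Real.sinc (t * kgSymbol m k) - 1) := by
    rw [sinSymbol]
    ring
  rw [this, abs_mul]
  refine (mul_le_mul_of_nonneg_left (abs_sinc_sub_one_le _) (abs_nonneg t)).trans_eq ?_
  rw [abs_mul, abs_of_nonneg (kgSymbol_nonneg m k), ← sq_abs t]
  ring

theorem kgSymbol_le {m k : ℝ} (hm : 0 ≤ m) (hk : 0 ≤ k) :
    kgSymbol m k ≤ √m + 2 * Real.pi * k := by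
  rw [kgSymbol]
  have h := Real.sqrt_nonneg m
  have h' : 0 ≤ 2 * Real.pi * k := by positivity
  refine Real.sqrt_le_iff.2 ⟨by positivity, ?_⟩
  nlinarith [Real.sq_sqrt hm, mul_nonneg h h']

theorem le_kgSymbol {m k : ℝ} (hm : 0 ≤ m) : 2 * Real.pi * k ≤ kgSymbol m k :=
  Real.le_sqrt_of_sq_le (by linarith)

/-- Freezes the oscillation at the centre of a frequency bump. The error does not depend on a: the
symbol differs from 2πa by at most √m + 2πr, however high the frequency. -/
theorem abs_cosSymbol_sub_cos_le {m k a r : ℝ} (hm : 0 ≤ m) (hk : 0 ≤ k) (h : |k - a| ≤ r)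
    (t : ℝ) :
    |cosSymbol m t k - Real.cos (t * (2 * Real.pi * a))| ≤ |t| * (√m + 2 * Real.pi * r) := by
  refine (Real.abs_cos_sub_cos_le _ _).trans ?_
  rw [← mul_sub, abs_mul]
  refine mul_le_mul_of_nonneg_left ?_ (abs_nonneg t)
  have h1 := kgSymbol_le hm hk
  have h2 := le_kgSymbol (k := k) hm
  obtain ⟨h3, h4⟩ := abs_le.1 h
  have h5 := Real.sqrt_nonneg m
  have hp := Real.pi_pos
  rw [abs_le]
  constructor <;> nlinarith

theorem measurable_cosSymbol (m t : ℝ) : Measurable (cosSymbol m t) := by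
  unfold cosSymbol kgSymbol
  fun_prop

theorem measurable_sinSymbol (m t : ℝ) : Measurable (sinSymbol m t) := by
  unfold sinSymbol kgSymbol
  exact (Real.continuous_sinc.measurable.comp (by fun_prop)).const_mul t

section Operators

variable {X : Type*} [MeasurableSpace X] {μ : Measure X} {κ : X → ℝ}

/-- The operator `cos (t √(m - Δ))` on the Fourier side. -/
def cosOp (μ : Measure X) (hκ : Measurable κ) (m t : ℝ) : Lp ℂ 1 μ →L[ℂ] Lp ℂ 1 μ :=
  mulOp μ (fun ξ => cosSymbol m t (κ ξ)) ((measurable_cosSymbol m t).comp hκ) 1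
    fun ξ => abs_cosSymbol_le m t (κ ξ)

/-- The operator `sin (t √(m - Δ)) / √(m - Δ)` on the Fourier side. -/
def sinOp (μ : Measure X) (hκ : Measurable κ) (m t : ℝ) : Lp ℂ 1 μ →L[ℂ] Lp ℂ 1 μ :=
  mulOp μ (fun ξ => sinSymbol m t (κ ξ)) ((measurable_sinSymbol m t).comp hκ) |t|
    fun ξ => abs_sinSymbol_le m t (κ ξ)

variable {hκ : Measurable κ} {m : ℝ}

theorem coe_cosOp (t : ℝ) (F : Lp ℂ 1 μ) :
    cosOp μ hκ m t F =ᵐ[μ] fun ξ => (cosSymbol m t (κ ξ) : ℂ) * F ξ := coe_mulOp F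

theorem coe_sinOp (t : ℝ) (F : Lp ℂ 1 μ) :
    sinOp μ hκ m t F =ᵐ[μ] fun ξ => (sinSymbol m t (κ ξ) : ℂ) * F ξ := coe_mulOp F

theorem norm_cosOp_apply_le (t : ℝ) (F : Lp ℂ 1 μ) : ‖cosOp μ hκ m t F‖ ≤ ‖F‖ := by
  refine (norm_mulOp_apply_le (fun ξ => abs_cosSymbol_le m t (κ ξ)) F).trans_eq (one_mul _)

theorem norm_sinOp_apply_le (t : ℝ) (F : Lp ℂ 1 μ) : ‖sinOp μ hκ m t F‖ ≤ |t| * ‖F‖ :=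
  norm_mulOp_apply_le (fun ξ => abs_sinSymbol_le m t (κ ξ)) F

theorem norm_sinOp_le (t : ℝ) : ‖sinOp μ hκ m t‖ ≤ |t| :=
  ContinuousLinearMap.opNorm_le_bound _ (abs_nonneg t) (norm_sinOp_apply_le t)

theorem continuous_sinOp : Continuous (sinOp μ hκ m) := by
  refine LipschitzWith.continuous (K := 1) (LipschitzWith.of_dist_le_mul fun t t' => ?_)
  rw [dist_eq_norm, Real.dist_eq, NNReal.coe_one, one_mul]
  refine ContinuousLinearMap.opNorm_le_bound _ (abs_nonneg _) fun F => ?_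
  exact norm_mulOp_sub_le (fun ξ => abs_sinSymbol_sub_le m t t' (κ ξ)) F

/-- There is no Lipschitz bound uniform in frequency here, so strong continuity is obtained by
dominated convergence. -/
theorem continuous_cosOp_apply (F : Lp ℂ 1 μ) : Continuous fun t => cosOp μ hκ m t F := by
  rw [continuous_iff_continuousAt]
  intro t₀
  rw [ContinuousAt, tendsto_iff_norm_sub_tendsto_zero]
  have hle : ∀ t, ‖cosOp μ hκ m t F - cosOp μ hκ m t₀ F‖ ≤
      ∫ ξ, |cosSymbol m t (κ ξ) - cosSymbol m t₀ (κ ξ)| * ‖F ξ‖ ∂μ := by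
    intro t
    rw [L1.norm_eq_integral_norm]
    refine (integral_congr_ae ?_).le
    filter_upwards [Lp.coeFn_sub (cosOp μ hκ m t F) (cosOp μ hκ m t₀ F),
      coe_cosOp (hκ := hκ) (m := m) t F, coe_cosOp (hκ := hκ) (m := m) t₀ F] with ξ h1 h2 h3
    rw [h1, Pi.sub_apply, h2, h3, ← sub_mul, norm_mul, ← Complex.ofReal_sub,
      Complex.norm_real, Real.norm_eq_abs]
  have hc : Continuous fun t => ∫ ξ, |cosSymbol m t (κ ξ) - cosSymbol m t₀ (κ ξ)| * ‖F ξ‖ ∂μ := by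
    refine continuous_of_dominated (bound := fun ξ => 2 * ‖F ξ‖) (fun t => ?_) (fun t => ?_)
      ((integrable_coe F).norm.const_mul 2) (Eventually.of_forall fun ξ => ?_)
    · have h1 := (measurable_cosSymbol m t).comp hκ
      have h2 := (measurable_cosSymbol m t₀).comp hκ
      exact (h1.sub h2).norm.aestronglyMeasurable.mul (integrable_coe F).norm.aestronglyMeasurable
    · refine Eventually.of_forall fun ξ => ?_
      rw [norm_mul, norm_norm, Real.norm_eq_abs, abs_abs]
      refine mul_le_mul_of_nonneg_right ?_ (norm_nonneg _)
      have h1 := abs_le.1 (abs_cosSymbol_le m t (κ ξ))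
      have h2 := abs_le.1 (abs_cosSymbol_le m t₀ (κ ξ))
      rw [abs_le]
      constructor <;> linarith
    · unfold cosSymbol
      fun_prop
  refine squeeze_zero (fun t => norm_nonneg _) hle ?_
  have := hc.tendsto t₀
  simpa using this

end Operators

section Admissible

variable {X : Type*} [AddCommGroup X] [MeasurableSpace X] {μ : Measure X}

/-- The Fourier transforms of real functions that are bounded by `D`. -/
def admissible (μ : Measure X) (D : ℝ) : Set (Lp ℂ 1 μ) :=
  {F | IsHermitian F ∧ ∀ᵐ x ∂μ, ‖F x‖ ≤ D}

theorem admissible_mono {D D' : ℝ} (h : D ≤ D') : admissible μ D ⊆ admissible μ D' :=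
  fun _ hF => ⟨hF.1, hF.2.mono fun _ hx => hx.trans h⟩

variable [MeasurableNeg X] [μ.IsNegInvariant]

theorem ae_neg {p : X → Prop} (h : ∀ᵐ x ∂μ, p x) : ∀ᵐ x ∂μ, p (-x) :=
  (Measure.measurePreserving_neg μ).quasiMeasurePreserving.ae h

theorem IsHermitian.add {F G : Lp ℂ 1 μ} (hF : IsHermitian F) (hG : IsHermitian G) :
    IsHermitian (F + G) := by
  filter_upwards [Lp.coeFn_add F G, ae_neg (Lp.coeFn_add F G), hF, hG] with x h1 h2 h3 h4
  rw [h1, h2, Pi.add_apply, Pi.add_apply, h3, h4, map_add]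

theorem IsHermitian.smul {F : Lp ℂ 1 μ} (hF : IsHermitian F) (a : ℝ) : IsHermitian (a • F) := by
  filter_upwards [Lp.coeFn_smul a F, ae_neg (Lp.coeFn_smul a F), hF] with x h1 h2 h3
  rw [h1, h2, Pi.smul_apply, Pi.smul_apply, h3, Complex.real_smul, Complex.real_smul, map_mul,
    Complex.conj_ofReal]

theorem IsHermitian.sub {F G : Lp ℂ 1 μ} (hF : IsHermitian F) (hG : IsHermitian G) :
    IsHermitian (F - G) := by
  filter_upwards [Lp.coeFn_sub F G, ae_neg (Lp.coeFn_sub F G), hF, hG] with x h1 h2 h3 h4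
  rw [h1, h2, Pi.sub_apply, Pi.sub_apply, h3, h4, map_sub]

theorem add_mem_admissible {F G : Lp ℂ 1 μ} {D D' : ℝ} (hF : F ∈ admissible μ D)
    (hG : G ∈ admissible μ D') : F + G ∈ admissible μ (D + D') := by
  refine ⟨hF.1.add hG.1, ?_⟩
  filter_upwards [Lp.coeFn_add F G, hF.2, hG.2] with x h1 h2 h3
  rw [h1, Pi.add_apply]
  exact (norm_add_le _ _).trans (add_le_add h2 h3)

theorem sub_mem_admissible {F G : Lp ℂ 1 μ} {D D' : ℝ} (hF : F ∈ admissible μ D)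
    (hG : G ∈ admissible μ D') : F - G ∈ admissible μ (D + D') := by
  refine ⟨hF.1.sub hG.1, ?_⟩
  filter_upwards [Lp.coeFn_sub F G, hF.2, hG.2] with x h1 h2 h3
  rw [h1, Pi.sub_apply]
  exact (norm_sub_le _ _).trans (add_le_add h2 h3)

theorem smul_mem_admissible {F : Lp ℂ 1 μ} {D : ℝ} (hF : F ∈ admissible μ D) (a : ℝ) :
    a • F ∈ admissible μ (|a| * D) := by
  refine ⟨hF.1.smul a, ?_⟩
  filter_upwards [Lp.coeFn_smul a F, hF.2] with x h1 h2
  rw [h1, Pi.smul_apply, norm_smul, Real.norm_eq_abs]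
  exact mul_le_mul_of_nonneg_left h2 (abs_nonneg a)

theorem zero_mem_admissible {D : ℝ} (hD : 0 ≤ D) : (0 : Lp ℂ 1 μ) ∈ admissible μ D := by
  have h := Lp.coeFn_zero ℂ 1 μ
  refine ⟨?_, ?_⟩
  · filter_upwards [h, ae_neg h] with x h1 h2
    rw [h1, h2]
    simp
  · filter_upwards [h] with x h1
    rw [h1]
    simpa using hD

theorem convex_admissible (D : ℝ) : Convex ℝ (admissible μ D) := by
  intro F hF G hG a b ha hb hab
  have := add_mem_admissible (smul_mem_admissible hF a) (smul_mem_admissible hG b)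
  rwa [abs_of_nonneg ha, abs_of_nonneg hb, ← add_mul, hab, one_mul] at this

/-- An L¹ limit is an almost everywhere limit along a subsequence, and both conditions pass to
pointwise limits. -/
theorem isClosed_admissible (D : ℝ) : IsClosed (admissible μ D) := by
  refine IsSeqClosed.isClosed fun F G hF hG => ?_
  obtain ⟨φ, -, hφ⟩ := (tendstoInMeasure_of_tendsto_Lp hG).exists_seq_tendsto_ae
  have h1 : ∀ᵐ x ∂μ, ∀ n, F n (-x) = conj (F n x) := ae_all_iff.2 fun n => (hF n).1
  have h2 : ∀ᵐ x ∂μ, ∀ n, ‖F n x‖ ≤ D := ae_all_iff.2 fun n => (hF n).2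
  constructor
  · filter_upwards [hφ, ae_neg hφ, h1] with x hx hx' hn
    refine tendsto_nhds_unique hx' ?_
    simp_rw [hn]
    exact (Complex.continuous_conj.tendsto _).comp hx
  · filter_upwards [hφ, h2] with x hx hn
    exact le_of_tendsto hx.norm (Eventually.of_forall fun n => hn (φ n))

theorem mulOp_mem_admissible {F : Lp ℂ 1 μ} {D : ℝ} (hF : F ∈ admissible μ D) {a : X → ℝ}
    {ha : Measurable a} {c k : ℝ} {hc : ∀ x, |a x| ≤ c} (heven : ∀ x, a (-x) = a x)
    (hk : ∀ x, |a x| ≤ k) : mulOp μ a ha c hc F ∈ admissible μ (k * D) := by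
  refine ⟨hF.1.mulOp heven, ?_⟩
  filter_upwards [coe_mulOp (ha := ha) (hc := hc) F, hF.2] with x h1 h2
  rw [h1, norm_mul, Complex.norm_real, Real.norm_eq_abs]
  exact mul_le_mul (hk x) h2 (norm_nonneg _) ((abs_nonneg _).trans (hk x))

variable {κ : X → ℝ} {hκ : Measurable κ} {m : ℝ}

theorem cosOp_mem_admissible (heven : ∀ ξ, κ (-ξ) = κ ξ) {F : Lp ℂ 1 μ} {D : ℝ}
    (hF : F ∈ admissible μ D) (t : ℝ) : cosOp μ hκ m t F ∈ admissible μ D := by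
  refine admissible_mono (one_mul D).le ?_
  exact mulOp_mem_admissible hF (fun ξ => by rw [heven]) (fun ξ => abs_cosSymbol_le m t (κ ξ))

theorem sinOp_mem_admissible (heven : ∀ ξ, κ (-ξ) = κ ξ) {F : Lp ℂ 1 μ} {D : ℝ}
    (hF : F ∈ admissible μ D) (t : ℝ) : sinOp μ hκ m t F ∈ admissible μ (|t| * D) :=
  mulOp_mem_admissible hF (fun ξ => by rw [heven]) (fun ξ => abs_sinSymbol_le m t (κ ξ))

end Admissible

section Solution

variable {X : Type*} [AddCommGroup X] [MeasurableSpace X] [MeasurableAdd₂ X] [MeasurableNeg X]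
  {μ : Measure X} [SFinite μ] [μ.IsAddLeftInvariant] [μ.IsNegInvariant]

theorem continuous_cube : Continuous (cube (μ := μ)) := by
  unfold cube
  fun_prop

theorem cube_mem_admissible {U : Lp ℂ 1 μ} {r D : ℝ} (hr : ‖U‖ ≤ r) (hU : U ∈ admissible μ D) :
    cube U ∈ admissible μ (r ^ 2 * D) :=
  ⟨hU.1.cube, norm_cube_apply_le hr hU.2⟩

variable {κ : X → ℝ} {hκ : Measurable κ} {m : ℝ}

/-- The admissible class is invariant under the Duhamel map: since T ≤ 1, the two linear terms have
sup bound D each, and the smallness of T leaves at most D for the nonlinear term, whence 3D. -/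
theorem exists_fourier_solution (heven : ∀ ξ, κ (-ξ) = κ ξ) {V₀ V₁ : Lp ℂ 1 μ} {B D T : ℝ}
    (hT : 0 < T) (hT1 : T ≤ 1) (hV₀ : V₀ ∈ admissible μ D) (hV₁ : V₁ ∈ admissible μ D)
    (hD : 0 ≤ D)
    (hB : ‖V₀‖ + ‖V₁‖ ≤ B) (hTB : 24 * T ^ 2 * B ^ 2 ≤ 1) :
    ∃ U : ℝ → Lp ℂ 1 μ, Continuous U ∧ (∀ t, U t ∈ admissible μ (3 * D) ∧ ‖U t‖ ≤ 2 * B) ∧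
      ∀ t ∈ Icc (-T) T, U t = cosOp μ hκ m t V₀ + sinOp μ hκ m t V₁
        - duhamel (sinOp μ hκ m) (fun τ => cube (U τ)) t := by
  have hB0 : 0 ≤ B := by linarith [norm_nonneg V₀, norm_nonneg V₁]
  refine exists_volterra_solution (C := cube) (L := fun t => cosOp μ hκ m t V₀ + sinOp μ hκ m t V₁)
    (fun r U => norm_cube_le) (fun r U V => norm_cube_sub_le)
    continuous_cube continuous_sinOp norm_sinOp_le
    ((continuous_cosOp_apply V₀).add (continuous_sinOp.clm_apply continuous_const)) hT hB0 ?_ hTB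
    (isClosed_admissible _) (zero_mem_admissible (by positivity)) ?_
  · intro t ht
    refine (norm_add_le _ _).trans ?_
    have h1 := norm_cosOp_apply_le (hκ := hκ) (m := m) t V₀
    have h2 := norm_sinOp_apply_le (hκ := hκ) (m := m) t V₁
    have h3 : |t| * ‖V₁‖ ≤ 1 * ‖V₁‖ :=
      mul_le_mul_of_nonneg_right ((abs_le.2 ht).trans hT1) (norm_nonneg _)
    linarith
  · intro U hU hUm t ht
    have ht' : |t| ≤ T := abs_le.2 ht
    have h1 : cosOp μ hκ m t V₀ + sinOp μ hκ m t V₁ ∈ admissible μ (D + D) :=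
      add_mem_admissible (cosOp_mem_admissible heven hV₀ t)
        (admissible_mono (mul_le_of_le_one_left hD (ht'.trans hT1))
          (sinOp_mem_admissible heven hV₁ t))
    have h2 : duhamel (sinOp μ hκ m) (fun τ => cube (U τ)) t ∈ admissible μ D := by
      rcases eq_or_ne t 0 with rfl | ht0
      · rw [duhamel, intervalIntegral.integral_same]
        exact zero_mem_admissible hD
      refine intervalIntegral_mem_of_convex (convex_admissible D) (isClosed_admissible D)
        (continuous_duhamel_integrand continuous_sinOp (continuous_cube.comp hU) t) ht0
        fun τ hτ => ?_
      refine admissible_mono ?_ (smul_mem_admissible (sinOp_mem_admissible heven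
        (cube_mem_admissible (hUm τ).2 (hUm τ).1) (t - τ)) t)
      have h3 := (abs_sub_le_of_mem_uIoc hτ ht).1
      -- One factor T comes from the propagator and one from scaling by t in the convexity lemma.
      calc |t| * (|t - τ| * ((2 * B) ^ 2 * (3 * D)))
          ≤ T * (T * ((2 * B) ^ 2 * (3 * D))) := by gcongr
        _ = (24 * T ^ 2 * B ^ 2) * D / 2 := by ring
        _ ≤ 1 * D / 2 := by gcongr
        _ ≤ D := by linarith
    refine admissible_mono ?_ (sub_mem_admissible h1 h2)
    linarith

end Solution

end

/-! ### From Fourier transforms back to functions. -/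

section

/-- A family of unitary characters of `X`, depending continuously on a parameter in `M`. -/
structure IsCharacterFamily {X M : Type*} [AddCommGroup X] [MeasurableSpace X]
    [TopologicalSpace M] (e : X → M → ℂ) : Prop where
  measurable : ∀ x, Measurable fun ξ => e ξ x
  continuous : ∀ ξ, Continuous (e ξ)
  norm_eq_one : ∀ ξ x, ‖e ξ x‖ = 1
  map_add : ∀ ξ η x, e (ξ + η) x = e ξ x * e η x
  map_neg : ∀ ξ x, e (-ξ) x = conj (e ξ x)

section Synthesis

variable {X M : Type*} [AddCommGroup X] [MeasurableSpace X]
  {μ : Measure X} [TopologicalSpace M] {e : X → M → ℂ}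

/-- Evaluation at `x` of the function with the given Fourier transform. -/
def evalAt (μ : Measure X) (he : IsCharacterFamily e) (x : M) : Lp ℂ 1 μ →L[ℂ] ℂ :=
  pairing μ (fun ξ => e ξ x) (he.measurable x) 1 fun ξ => (he.norm_eq_one ξ x).le

theorem evalAt_apply (he : IsCharacterFamily e) (x : M) (F : Lp ℂ 1 μ) :
    evalAt μ he x F = ∫ ξ, F ξ * e ξ x ∂μ := by
  rw [evalAt, pairing_apply]
  simp_rw [mul_comm]

theorem norm_evalAt_le (he : IsCharacterFamily e) (x : M) (F : Lp ℂ 1 μ) :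
    ‖evalAt μ he x F‖ ≤ ‖F‖ :=
  (norm_pairing_le F).trans_eq (one_mul _)

theorem continuous_evalAt [FirstCountableTopology M] (he : IsCharacterFamily e) (F : Lp ℂ 1 μ) :
    Continuous fun x => evalAt μ he x F := by
  simp_rw [evalAt_apply]
  refine continuous_of_dominated (bound := fun ξ => ‖F ξ‖) (fun x => ?_) (fun x => ?_)
    (integrable_coe F).norm (Eventually.of_forall fun ξ => continuous_const.mul (he.continuous ξ))
  · exact (integrable_coe F).aestronglyMeasurable.mul (he.measurable x).aestronglyMeasurable
  · exact Eventually.of_forall fun ξ => by rw [norm_mul, he.norm_eq_one, mul_one]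

/-- The (real part of the) function with the given integrable Fourier transform. -/
def synth [FirstCountableTopology M] (he : IsCharacterFamily e) (F : Lp ℂ 1 μ) : M →ᵇ ℝ :=
  BoundedContinuousFunction.ofNormedAddCommGroup (fun x => (evalAt μ he x F).re)
    (Complex.continuous_re.comp (continuous_evalAt he F)) ‖F‖
    fun x => (Complex.abs_re_le_norm _).trans (norm_evalAt_le he x F)

theorem synth_sub [FirstCountableTopology M] (he : IsCharacterFamily e) (F G : Lp ℂ 1 μ) :
    synth he F - synth he G = synth he (F - G) := by
  ext x
  change (evalAt μ he x F).re - (evalAt μ he x G).re = (evalAt μ he x (F - G)).re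
  rw [map_sub, Complex.sub_re]

theorem evalAt_mulOp (he : IsCharacterFamily e) (x : M) {a : X → ℝ} {ha : Measurable a} {c : ℝ}
    {hc : ∀ x, |a x| ≤ c} (F : Lp ℂ 1 μ) :
    evalAt μ he x (mulOp μ a ha c hc F) = multiplierApply μ e a F x := by
  rw [evalAt_apply, multiplierApply]
  refine integral_congr_ae ?_
  filter_upwards [coe_mulOp (ha := ha) (hc := hc) F] with ξ h
  rw [h]

variable [MeasurableNeg X] [μ.IsNegInvariant]

theorem IsHermitian.conj_evalAt {F : Lp ℂ 1 μ} (hF : IsHermitian F) (he : IsCharacterFamily e)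
    (x : M) : conj (evalAt μ he x F) = evalAt μ he x F := by
  rw [evalAt_apply, ← integral_conj, ← integral_neg_eq_self]
  refine integral_congr_ae ?_
  filter_upwards [hF] with ξ h
  rw [map_mul, h, he.map_neg, Complex.conj_conj, Complex.conj_conj]

/-- Hermitian symmetry makes the evaluation real, so the real part in `synth` loses nothing. -/
theorem IsHermitian.coe_synth [FirstCountableTopology M] {F : Lp ℂ 1 μ} (hF : IsHermitian F)
    (he : IsCharacterFamily e) (x : M) : (synth he F x : ℂ) = evalAt μ he x F :=
  Complex.conj_eq_iff_re.1 (hF.conj_evalAt he x)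

theorem IsHermitian.hasWienerTransform_synth [FirstCountableTopology M] {F : Lp ℂ 1 μ}
    (hF : IsHermitian F) (he : IsCharacterFamily e) : HasWienerTransform μ e (synth he F) F :=
  fun x => by rw [hF.coe_synth he, evalAt_apply]

variable [MeasurableAdd₂ X] [SFinite μ] [μ.IsAddLeftInvariant]

theorem evalAt_conv (he : IsCharacterFamily e) (x : M) (F G : Lp ℂ 1 μ) :
    evalAt μ he x (conv μ F G) = evalAt μ he x F * evalAt μ he x G := by
  have h := integral_mul_conv (he.measurable x) (fun ξ => (he.norm_eq_one ξ x).le) F G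
  rw [evalAt, pairing_apply, pairing_apply, pairing_apply, h, ← integral_mul_const]
  congr 1
  funext t
  simp_rw [he.map_add, mul_assoc]
  rw [integral_const_mul]
  ring

theorem evalAt_cube (he : IsCharacterFamily e) (x : M) (F : Lp ℂ 1 μ) :
    evalAt μ he x (cube F) = evalAt μ he x F ^ 3 := by
  rw [cube, evalAt_conv, evalAt_conv]
  ring

variable {κ : X → ℝ} {hκ : Measurable κ} {m : ℝ}

theorem isNLWSolution_synth [FirstCountableTopology M] (he : IsCharacterFamily e)
    {V₀ V₁ : Lp ℂ 1 μ} {U : ℝ → Lp ℂ 1 μ} {T : ℝ} (hV₀ : IsHermitian V₀) (hV₁ : IsHermitian V₁)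
    (hU : Continuous U) (hUh : ∀ t, IsHermitian (U t))
    (heq : ∀ t ∈ Icc (-T) T, U t = cosOp μ hκ m t V₀ + sinOp μ hκ m t V₁
        - duhamel (sinOp μ hκ m) (fun τ => cube (U τ)) t) :
    IsNLWSolution μ e κ m T (synth he V₀) (synth he V₁) (fun t => synth he (U t)) := by
  refine ⟨V₀, V₁, U, fun τ => cube (U τ), hV₀.hasWienerTransform_synth he,
    hV₁.hasWienerTransform_synth he, hU.continuousOn,
    fun t ht => ⟨(hUh t).hasWienerTransform_synth he, fun x => ?_, fun x => ?_⟩⟩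
  · rw [Complex.ofReal_pow, (hUh t).coe_synth he, ← evalAt_cube, evalAt_apply]
  · rw [(hUh t).coe_synth he]
    conv_lhs => rw [heq t ht]
    rw [map_sub, map_add, map_duhamel continuous_sinOp (G := fun τ => cube (U τ))
        (continuous_cube.comp hU),
      cosOp, evalAt_mulOp, sinOp, evalAt_mulOp]
    congr 1
    refine intervalIntegral.integral_congr fun τ _ => ?_
    rw [sinOp, evalAt_mulOp]

end Synthesis

end

/-! ### Frequency bumps and their resonant interaction. -/

section

/-- The length `κ` on the frequency space `X` is subadditive with balls of finite measure, and `θ`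
is a vector of length one. -/
structure IsFrequencySpace {X : Type*} [AddCommGroup X] [MeasurableSpace X] (μ : Measure X)
    (κ : X → ℝ) (θ : X) : Prop where
  measurable : Measurable κ
  nonneg : ∀ ξ, 0 ≤ κ ξ
  map_neg : ∀ ξ, κ (-ξ) = κ ξ
  map_add_le : ∀ ξ η, κ (ξ + η) ≤ κ ξ + κ η
  map_zsmul : ∀ k : ℤ, κ (k • θ) = |(k : ℝ)|
  measure_ball_lt_top : ∀ r, μ {ξ | κ ξ ≤ r} < ⊤
  measure_ball_pos : ∀ r, 0 < r → 0 < μ {ξ | κ ξ ≤ r}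

/-- The ball of radius `1 / 12` around `k θ`. -/
def bumpSet {X : Type*} [AddCommGroup X] (κ : X → ℝ) (θ : X) (k : ℤ) : Set X :=
  {ξ | κ (ξ - k • θ) ≤ 1 / 12}

theorem norm_indicator_one_le {X : Type*} (s : Set X) (x : X) :
    ‖s.indicator (fun _ => (1 : ℂ)) x‖ ≤ 1 := by
  by_cases hx : x ∈ s <;> simp [hx]

namespace IsFrequencySpace

variable {X : Type*} [AddCommGroup X] [MeasurableSpace X] {μ : Measure X} {κ : X → ℝ} {θ : X}

theorem map_sub_le (h : IsFrequencySpace μ κ θ) (ξ η : X) : κ (ξ - η) ≤ κ ξ + κ η := by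
  rw [sub_eq_add_neg, ← h.map_neg η]
  exact h.map_add_le _ _

theorem abs_sub_le (h : IsFrequencySpace μ κ θ) {ξ : X} {k : ℤ} (hξ : ξ ∈ bumpSet κ θ k) :
    |κ ξ - abs (k : ℝ)| ≤ 1 / 12 := by
  have h1 : κ (ξ - k • θ) ≤ 1 / 12 := hξ
  have h2 := h.map_add_le (ξ - k • θ) (k • θ)
  have h3 := h.map_sub_le ξ (ξ - k • θ)
  rw [sub_add_cancel, h.map_zsmul] at h2
  rw [sub_sub_cancel, h.map_zsmul] at h3
  rw [abs_le]
  constructor <;> linarith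

theorem neg_mem_bumpSet (h : IsFrequencySpace μ κ θ) {ξ : X} {k : ℤ} :
    -ξ ∈ bumpSet κ θ k ↔ ξ ∈ bumpSet κ θ (-k) := by
  have : -ξ - k • θ = -(ξ - (-k) • θ) := by
    rw [neg_smul]
    abel
  rw [bumpSet, bumpSet, mem_ofPred_eq, mem_ofPred_eq, this, h.map_neg]

/-- Three errors of 1/12 add up to 1/4, so a sum lies within 1/4 of (i + j + k)θ. If that integer is
nonzero the length of the sum is at least 3/4: the low frequency ball sees a triple of bumps
entirely or not at all. -/
theorem add_mem_bumpSets (h : IsFrequencySpace μ κ θ) {i j k : ℤ} {x y z : X}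
    (hx : x ∈ bumpSet κ θ i) (hy : y ∈ bumpSet κ θ j) (hz : z ∈ bumpSet κ θ k) : κ (x + (y + z)) ≤ 1 / 4 ↔ i + j + k = 0 := by
  have h1 : κ (x - i • θ) ≤ 1 / 12 := hx
  have h2 : κ (y - j • θ) ≤ 1 / 12 := hy
  have h3 : κ (z - k • θ) ≤ 1 / 12 := hz
  have h4 := h.map_add_le (x - i • θ) ((y - j • θ) + (z - k • θ))
  have h5 := h.map_add_le (y - j • θ) (z - k • θ)
  have e : (x - i • θ) + ((y - j • θ) + (z - k • θ)) = (x + (y + z)) - (i + j + k) • θ := by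
    rw [add_smul, add_smul]
    abel
  rw [e] at h4
  constructor
  · intro h6
    by_contra hne
    have h7 := h.map_sub_le (x + (y + z)) ((x + (y + z)) - (i + j + k) • θ)
    rw [sub_sub_cancel, h.map_zsmul] at h7
    have h8 : (1 : ℝ) ≤ |((i + j + k : ℤ) : ℝ)| := by
      rw [← Int.cast_abs]
      exact_mod_cast Int.one_le_abs hne
    linarith
  · intro h6
    rw [h6, zero_smul, sub_zero] at h4
    linarith

/-- The volume of the ball of radius `1 / 12`. -/
def vol (_ : IsFrequencySpace μ κ θ) : ℝ := μ.real {ξ | κ ξ ≤ 1 / 12}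

theorem vol_pos (h : IsFrequencySpace μ κ θ) : 0 < h.vol :=
  ENNReal.toReal_pos (h.measure_ball_pos _ (by norm_num)).ne' (h.measure_ball_lt_top _).ne

/-- Integration over the ball of radius `1 / 4`. -/
def lowFreq (h : IsFrequencySpace μ κ θ) : Lp ℂ 1 μ →L[ℂ] ℂ :=
  pairing μ ({ξ | κ ξ ≤ 1 / 4}.indicator fun _ => 1)
    (measurable_const.indicator (measurableSet_le h.measurable measurable_const)) 1
    fun ξ => norm_indicator_one_le _ ξ

theorem norm_lowFreq_le (h : IsFrequencySpace μ κ θ) (F : Lp ℂ 1 μ) : ‖h.lowFreq F‖ ≤ ‖F‖ :=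
  (norm_pairing_le F).trans_eq (one_mul _)

variable [MeasurableAdd₂ X]

theorem measurableSet_bumpSet (h : IsFrequencySpace μ κ θ) (k : ℤ) :
    MeasurableSet (bumpSet κ θ k) := by
  have : Measurable fun ξ : X => κ (ξ - k • θ) := by
    simp_rw [sub_eq_add_neg]
    exact h.measurable.comp (measurable_id.add_const _)
  exact measurableSet_le this measurable_const

variable [μ.IsAddLeftInvariant]

theorem measure_bumpSet (h : IsFrequencySpace μ κ θ) (k : ℤ) :
    μ (bumpSet κ θ k) = μ {ξ | κ ξ ≤ 1 / 12} := by
  have := (measurePreserving_add_right μ (-(k • θ))).measure_preimage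
    (s := {ξ | κ ξ ≤ 1 / 12}) (measurableSet_le h.measurable measurable_const).nullMeasurableSet
  rw [← this]
  simp only [bumpSet, sub_eq_add_neg, preimage_ofPred_eq]

theorem measure_bumpSet_ne_top (h : IsFrequencySpace μ κ θ) (k : ℤ) :
    μ (bumpSet κ θ k) ≠ ⊤ := by
  rw [h.measure_bumpSet]
  exact (h.measure_ball_lt_top _).ne

/-- The indicator function of the ball around `k θ`. -/
def bump (h : IsFrequencySpace μ κ θ) (k : ℤ) : Lp ℂ 1 μ :=
  indicatorConstLp 1 (h.measurableSet_bumpSet k) (h.measure_bumpSet_ne_top k) 1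

variable (h : IsFrequencySpace μ κ θ)

theorem coe_bump (k : ℤ) : h.bump k =ᵐ[μ] (bumpSet κ θ k).indicator fun _ => (1 : ℂ) :=
  indicatorConstLp_coeFn

theorem norm_bump (k : ℤ) : ‖h.bump k‖ = h.vol := by
  rw [bump, norm_indicatorConstLp one_ne_zero ENNReal.one_ne_top]
  simp [vol, measureReal_def, h.measure_bumpSet]

theorem integral_bump (k : ℤ) : ∫ ξ, h.bump k ξ ∂μ = h.vol := by
  rw [integral_congr_ae (h.coe_bump k), integral_indicator_const _ (h.measurableSet_bumpSet k)]
  simp [vol, measureReal_def, h.measure_bumpSet]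

variable [SFinite μ] [MeasurableNeg X] [μ.IsNegInvariant]

/-- The indicator of the low ball is constant on sums from the three bumps, so the triple integral
is that constant times the product of the three volumes. -/
theorem lowFreq_conv_bump (i j k : ℤ) :
    h.lowFreq (conv μ (h.bump i) (conv μ (h.bump j) (h.bump k))) =
      if i + j + k = 0 then (h.vol : ℂ) ^ 3 else 0 := by
  set ψ : X → ℂ := {ξ | κ ξ ≤ 1 / 4}.indicator fun _ => 1 with hψ
  have hm : Measurable ψ :=
    measurable_const.indicator (measurableSet_le h.measurable measurable_const)
  have hb : ∀ ξ, ‖ψ ξ‖ ≤ 1 := fun ξ => norm_indicator_one_le _ ξ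
  set c : ℂ := if i + j + k = 0 then 1 else 0 with hc
  have key : ∀ᵐ x ∂μ, h.bump i x * ∫ y, ψ (x + y) * conv μ (h.bump j) (h.bump k) y ∂μ =
      h.bump i x * (c * h.vol ^ 2) := by
    filter_upwards [h.coe_bump i] with x hx
    rw [hx]
    by_cases hxi : x ∈ bumpSet κ θ i
    · congr 1
      rw [integral_mul_conv (ψ := fun y => ψ (x + y)) (hm.comp (measurable_const_add x))
        (fun y => hb _)]
      have : ∀ᵐ y ∂μ, h.bump j y * ∫ z, ψ (x + (y + z)) * h.bump k z ∂μ =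
          h.bump j y * (c * h.vol) := by
        filter_upwards [h.coe_bump j] with y hy
        rw [hy]
        by_cases hyj : y ∈ bumpSet κ θ j
        · congr 1
          rw [← h.integral_bump k, ← integral_const_mul]
          refine integral_congr_ae ?_
          filter_upwards [h.coe_bump k] with z hz
          rw [hz]
          by_cases hzk : z ∈ bumpSet κ θ k
          · congr 1
            have := h.add_mem_bumpSets hxi hyj hzk
            simp only [hψ, hc, indicator_apply, mem_ofPred_eq, this]
          · simp [hzk]
        · simp [hyj]
      rw [integral_congr_ae this, integral_mul_const, h.integral_bump]
      ring
    · simp [hxi]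
  rw [lowFreq, pairing_apply, integral_mul_conv hm hb, integral_congr_ae key, integral_mul_const,
    h.integral_bump, hc]
  split_ifs <;> ring

/-- The sum of four bumps at `± N θ` and `± 2 N θ`. -/
def wave (N : ℕ) (a b : ℝ) : Lp ℂ 1 μ :=
  ∑ i : Fin 4, (![a, a, b, b] i : ℂ) • h.bump (N * ![1, -1, 2, -2] i)

/-- The factor 6 counts the resonant ordered triples: the three arrangements of (1, 1, −2) and those
of (−1, −1, 2), each of weight a²b. -/
theorem lowFreq_cube_wave {N : ℕ} (hN : N ≠ 0) (a b : ℝ) :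
    h.lowFreq (cube (h.wave N a b)) = ((6 * a ^ 2 * b * h.vol ^ 3 : ℝ) : ℂ) := by
  have hN' : (N : ℤ) ≠ 0 := by exact_mod_cast hN
  simp only [cube, wave, map_sum, map_smul, sum_apply, smul_apply, h.lowFreq_conv_bump, ← mul_add,
    mul_eq_zero, hN', false_or, smul_eq_mul]
  simp [Fin.sum_univ_four]
  ring

end IsFrequencySpace

end

/-! ### Lower bound for the low frequencies of the solution. -/

section

/-- The oscillating factor equals 1/4 + cos(2wτ)/2 + cos(4wτ)/4. The constant gives t²/8, and each
cosine contributes a nonnegative multiple of 1 − cos. The bound is thus uniform in w, with no error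
term. -/
theorem integral_sub_mul_cos_sq_mul_cos {w : ℝ} (hw : w ≠ 0) (t : ℝ) :
    t ^ 2 / 8 ≤ ∫ τ in (0 : ℝ)..t,
      (t - τ) * (Real.cos (τ * w) ^ 2 * Real.cos (τ * (2 * w))) := by
  have hd : ∀ τ : ℝ, HasDerivAt (fun τ => -(t - τ) ^ 2 / 8
      + (t - τ) * (Real.sin (2 * w * τ) / (4 * w) + Real.sin (4 * w * τ) / (16 * w))
      - Real.cos (2 * w * τ) / (8 * w ^ 2) - Real.cos (4 * w * τ) / (64 * w ^ 2))
      ((t - τ) * (Real.cos (τ * w) ^ 2 * Real.cos (τ * (2 * w)))) τ := by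
    intro τ
    have h0 : HasDerivAt (fun τ : ℝ => t - τ) (-1) τ := by
      simpa using (hasDerivAt_id τ).const_sub t
    have h1 : ∀ c : ℝ, HasDerivAt (fun τ : ℝ => c * τ) c τ := fun c => by
      simpa using (hasDerivAt_id τ).const_mul c
    have h2 := ((((h0.pow 2).neg.div_const 8).add
      (h0.mul (((h1 (2 * w)).sin.div_const (4 * w)).add
        ((h1 (4 * w)).sin.div_const (16 * w))))).sub
      ((h1 (2 * w)).cos.div_const (8 * w ^ 2))).sub ((h1 (4 * w)).cos.div_const (64 * w ^ 2))
    refine h2.congr_deriv ?_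
    have e1 : Real.cos (τ * w) ^ 2 = (1 + Real.cos (2 * w * τ)) / 2 := by
      have := Real.cos_sq (τ * w)
      rw [this]
      have : 2 * (τ * w) = 2 * w * τ := by ring
      rw [this]
      ring
    have e2 : Real.cos (4 * w * τ) = 2 * Real.cos (2 * w * τ) ^ 2 - 1 := by
      rw [← Real.cos_two_mul]
      congr 1
      ring
    have e3 : τ * (2 * w) = 2 * w * τ := by ring
    simp only [Pi.add_apply]
    rw [e1, e2, e3]
    field_simp
    ring
  rw [intervalIntegral.integral_eq_sub_of_hasDerivAt (fun τ _ => hd τ)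
    ((by fun_prop : Continuous _).intervalIntegrable _ _)]
  have h1 := Real.cos_le_one (2 * w * t)
  have h2 := Real.cos_le_one (4 * w * t)
  have h3 : Real.cos (2 * w * t) / (8 * w ^ 2) ≤ 1 / (8 * w ^ 2) := by gcongr
  have h4 : Real.cos (4 * w * t) / (64 * w ^ 2) ≤ 1 / (64 * w ^ 2) := by gcongr
  simp only [sub_self, mul_zero, Real.sin_zero, Real.cos_zero, zero_div, add_zero, zero_mul,
    sub_zero]
  linarith

namespace IsFrequencySpace

variable {X : Type*} [AddCommGroup X] [MeasurableSpace X] {μ : Measure X} {κ : X → ℝ} {θ : X}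
  (h : IsFrequencySpace μ κ θ)

theorem norm_lowFreq_sinOp_sub_le {m : ℝ} (hm : 0 ≤ m) (s : ℝ) (G : Lp ℂ 1 μ) :
    ‖h.lowFreq (sinOp μ h.measurable m s G) - s * h.lowFreq G‖ ≤
      2 * s ^ 2 * (√m + 2 * Real.pi * (1 / 4)) * ‖G‖ := by
  have hψ : Measurable ({ξ | κ ξ ≤ 1 / 4}.indicator fun _ => (1 : ℂ)) :=
    measurable_const.indicator (measurableSet_le h.measurable measurable_const)
  rw [lowFreq, pairing_apply, pairing_apply, ← integral_const_mul,
    ← integral_sub (integrable_bdd_mul hψ (norm_indicator_one_le _) _)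
      ((integrable_bdd_mul hψ (norm_indicator_one_le _) _).const_mul _),
    L1.norm_eq_integral_norm, ← integral_const_mul]
  refine norm_integral_le_of_norm_le ((integrable_coe G).norm.const_mul _) ?_
  filter_upwards [coe_sinOp (hκ := h.measurable) (m := m) s G] with ξ h1
  rw [h1]
  by_cases hξ : ξ ∈ {ξ | κ ξ ≤ 1 / 4}
  · rw [indicator_of_mem hξ, one_mul, one_mul, ← sub_mul, norm_mul, ← Complex.ofReal_sub,
      Complex.norm_real, Real.norm_eq_abs]
    refine mul_le_mul_of_nonneg_right ((abs_sinSymbol_sub_self_le m s (κ ξ)).trans ?_)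
      (norm_nonneg _)
    refine mul_le_mul_of_nonneg_left ((kgSymbol_le hm (h.nonneg ξ)).trans ?_) (by positivity)
    have : κ ξ ≤ 1 / 4 := hξ
    gcongr
  · rw [indicator_of_notMem hξ]
    simp only [zero_mul, mul_zero, sub_zero, norm_zero]
    have := Real.pi_pos
    positivity

variable [MeasurableAdd₂ X] [μ.IsAddLeftInvariant]

theorem norm_wave_le (N : ℕ) {a b : ℝ} (ha : |a| ≤ 1) (hb : |b| ≤ 1) :
    ‖h.wave N a b‖ ≤ 4 * h.vol := by
  refine (norm_sum_le_of_le (f := fun i : Fin 4 => (![a, a, b, b] i : ℂ) •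
    h.bump (N * ![1, -1, 2, -2] i)) _ (n := fun _ => h.vol) fun i _ => ?_).trans_eq (by simp)
  rw [norm_smul, h.norm_bump, Complex.norm_real]
  refine mul_le_of_le_one_left h.vol_pos.le ?_
  fin_cases i <;> simpa

theorem norm_cosOp_bump_sub_le {m : ℝ} (hm : 0 ≤ m) (t : ℝ) (k : ℤ) :
    ‖cosOp μ h.measurable m t (h.bump k)
      - (Real.cos (t * (2 * Real.pi * abs (k : ℝ))) : ℂ) • h.bump k‖ ≤
      |t| * (√m + 2 * Real.pi * (1 / 12)) * h.vol := by
  rw [← h.norm_bump k]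
  refine norm_le_of_ae_le ?_
  filter_upwards [coe_cosOp (hκ := h.measurable) (m := m) t (h.bump k), h.coe_bump k,
    Lp.coeFn_smul (Real.cos (t * (2 * Real.pi * abs (k : ℝ))) : ℂ) (h.bump k),
    Lp.coeFn_sub (cosOp μ h.measurable m t (h.bump k))
      ((Real.cos (t * (2 * Real.pi * abs (k : ℝ))) : ℂ) • h.bump k)] with ξ h1 h2 h3 h4
  rw [h4, Pi.sub_apply, h1, h3, Pi.smul_apply, smul_eq_mul, ← sub_mul, norm_mul,
    ← Complex.ofReal_sub, Complex.norm_real, Real.norm_eq_abs, h2]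
  by_cases hξ : ξ ∈ bumpSet κ θ k
  · exact mul_le_mul_of_nonneg_right
      (abs_cosSymbol_sub_cos_le hm (h.nonneg ξ) (h.abs_sub_le hξ) t) (norm_nonneg _)
  · simp [hξ]

theorem norm_cosOp_wave_sub_le {m : ℝ} (hm : 0 ≤ m) (t : ℝ) (N : ℕ) :
    ‖cosOp μ h.measurable m t (h.wave N 1 1) - h.wave N (Real.cos (t * (2 * Real.pi * N)))
      (Real.cos (t * (2 * (2 * Real.pi * N))))‖ ≤
      |t| * (√m + 2 * Real.pi * (1 / 12)) * (4 * h.vol) := by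
  rw [wave, wave, map_sum, ← Finset.sum_sub_distrib]
  refine (norm_sum_le_of_le _ (n := fun _ => |t| * (√m + 2 * Real.pi * (1 / 12)) * h.vol)
    fun i _ => ?_).trans_eq (by simp; ring)
  refine le_trans (le_of_eq ?_) (h.norm_cosOp_bump_sub_le hm t (N * ![1, -1, 2, -2] i))
  have e : 2 * (2 * Real.pi * N) = 2 * Real.pi * (N * 2) := by ring
  rw [map_smul, e]
  fin_cases i <;> simp [abs_mul]

/-- A multiplier does not move supports, and a bump around a nonzero multiple of θ stays at length
at least 11/12. Hence the free wave never obscures the nonlinear output. -/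
theorem lowFreq_cosOp_wave (m t : ℝ) {N : ℕ} (hN : N ≠ 0) :
    h.lowFreq (cosOp μ h.measurable m t (h.wave N 1 1)) = 0 := by
  have key : ∀ k : ℤ, k ≠ 0 → h.lowFreq (cosOp μ h.measurable m t (h.bump k)) = 0 := by
    intro k hk
    rw [lowFreq, pairing_apply]
    refine integral_eq_zero_of_ae ?_
    filter_upwards [coe_cosOp (hκ := h.measurable) (m := m) t (h.bump k), h.coe_bump k]
      with ξ h1 h2
    rw [h1, h2]
    by_cases hξ : ξ ∈ bumpSet κ θ k
    · have h3 := abs_le.1 (h.abs_sub_le hξ)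
      have h4 : (1 : ℝ) ≤ |(k : ℝ)| := by
        rw [← Int.cast_abs]
        exact_mod_cast Int.one_le_abs hk
      have h5 : ξ ∉ {ξ | κ ξ ≤ 1 / 4} := fun h6 => by
        have h7 : κ ξ ≤ 1 / 4 := h6
        linarith
      rw [indicator_of_notMem h5]
      simp
    · simp [hξ]
  rw [wave, map_sum, map_sum]
  refine Finset.sum_eq_zero fun i _ => ?_
  rw [map_smul, map_smul, key, smul_zero]
  refine mul_ne_zero (by exact_mod_cast hN) ?_
  fin_cases i <;> simp

variable [SFinite μ] [MeasurableNeg X] [μ.IsNegInvariant]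

/-- The low frequencies of a solution whose data are the sum of a high frequency wave of amplitude
`R` and of a bounded part, at a time comparable to `1 / R`. -/
theorem norm_lowFreq_solution_ge {m : ℝ} (hm : 0 ≤ m) {N : ℕ} (hN : N ≠ 0) {F₀ F₁ : Lp ℂ 1 μ}
    {R A t : ℝ} (hA : A = 4 * (R * h.vol)) (hA0 : 0 < A) (ht : 0 < t)
    (ht1 : t ≤ 1) (htA : t * A = 1 / 1000) {U : ℝ → Lp ℂ 1 μ} (hU : Continuous U)
    (hUA : ∀ τ, ‖U τ‖ ≤ 4 * A)
    (heq : ∀ τ ∈ Icc (-t) t, U τ = cosOp μ h.measurable m τ (F₀ + (R : ℂ) • h.wave N 1 1)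
      + sinOp μ h.measurable m τ F₁ - duhamel (sinOp μ h.measurable m) (fun τ => cube (U τ)) τ) :
    8 / 10 ^ 9 * A - (2 * (‖F₀‖ + ‖F₁‖) + (√m + 2)) ≤ ‖h.lowFreq (U t)‖ := by
  set M := ‖F₀‖ + ‖F₁‖ with hM
  have hM0 : 0 ≤ M := by positivity
  have hv := h.vol_pos
  have hR : 0 ≤ R := by
    by_contra hR
    have : R * h.vol < 0 := mul_neg_of_neg_of_pos (not_le.1 hR) hv
    linarith
  set w : ℝ := 2 * Real.pi * N with hw
  have hw0 : w ≠ 0 := by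
    have : (N : ℝ) ≠ 0 := by exact_mod_cast hN
    have := Real.pi_ne_zero
    positivity
  set K := sinOp μ h.measurable m with hK
  set G : ℝ → Lp ℂ 1 μ := fun τ => cube (U τ) with hG
  have hGc : Continuous G := continuous_cube.comp hU
  have hGA : ∀ τ, ‖G τ‖ ≤ (4 * A) ^ 3 := fun τ => norm_cube_le (hUA τ)
  -- The model for the solution: each bump oscillates at the frequency of its centre, so its cube
  -- can be computed exactly at low frequencies.
  set P : ℝ → Lp ℂ 1 μ := fun τ =>
    (R : ℂ) • h.wave N (Real.cos (τ * w)) (Real.cos (τ * (2 * w))) with hP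
  have hPA : ∀ τ, ‖P τ‖ ≤ 4 * A := fun τ => by
    rw [hP]
    dsimp only
    rw [norm_smul, Complex.norm_real, Real.norm_of_nonneg hR]
    refine (mul_le_mul_of_nonneg_left (h.norm_wave_le N (Real.abs_cos_le_one _)
      (Real.abs_cos_le_one _)) hR).trans ?_
    linarith
  have hlin : ∀ τ ∈ Icc (-t) t, ‖cosOp μ h.measurable m τ F₀ + K τ F₁‖ ≤ M := fun τ hτ => by
    refine (norm_add_le _ _).trans (add_le_add (norm_cosOp_apply_le τ F₀) ?_)
    refine (norm_sinOp_apply_le τ F₁).trans (mul_le_of_le_one_left (norm_nonneg _) ?_)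
    exact (abs_le.2 hτ).trans ht1
  set Ω : ℝ := √m + 2 with hΩ
  have hΩ0 : 0 ≤ Ω := by positivity
  have hpi := Real.pi_lt_four
  have hpi0 := Real.pi_pos
  -- The three errors are the bounded part of the data, the spread of frequencies within each bump
  -- together with the mass, and the Duhamel term.
  have hUP : ∀ τ ∈ Icc (-t) t, ‖U τ - P τ‖ ≤ M + t * Ω * A + t ^ 2 * (4 * A) ^ 3 := by
    intro τ hτ
    have e : U τ - P τ = (cosOp μ h.measurable m τ F₀ + K τ F₁)
        + (R : ℂ) • (cosOp μ h.measurable m τ (h.wave N 1 1)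
          - h.wave N (Real.cos (τ * w)) (Real.cos (τ * (2 * w)))) - duhamel K G τ := by
      rw [heq τ hτ, map_add, map_smul, smul_sub]
      abel
    rw [e]
    refine (norm_sub_le _ _).trans (add_le_add ((norm_add_le _ _).trans
      (add_le_add (hlin τ hτ) ?_)) (norm_duhamel_le norm_sinOp_le hτ fun τ _ => hGA τ))
    rw [norm_smul, Complex.norm_real, Real.norm_of_nonneg hR]
    refine (mul_le_mul_of_nonneg_left (h.norm_cosOp_wave_sub_le hm τ N) hR).trans ?_
    have h1 : |τ| ≤ t := abs_le.2 hτ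
    have h2 : √m + 2 * Real.pi * (1 / 12) ≤ Ω := by
      rw [hΩ]
      linarith
    calc R * (|τ| * (√m + 2 * Real.pi * (1 / 12)) * (4 * h.vol))
        ≤ R * (t * Ω * (4 * h.vol)) := by gcongr
      _ = t * Ω * A := by
        rw [hA]
        ring
  set g : ℝ → ℝ := fun τ => Real.cos (τ * w) ^ 2 * Real.cos (τ * (2 * w)) with hg
  have hPg : ∀ τ, h.lowFreq (cube (P τ)) = ((6 / 64 * A ^ 3 * g τ : ℝ) : ℂ) := by
    intro τ
    have e : cube (P τ) =
        (R : ℂ) ^ 3 • cube (h.wave N (Real.cos (τ * w)) (Real.cos (τ * (2 * w)))) := by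
      simp only [hP, cube, map_smul, smul_apply, smul_smul]
      congr 1
      ring
    rw [e, map_smul, h.lowFreq_cube_wave hN, smul_eq_mul, ← Complex.ofReal_pow,
      ← Complex.ofReal_mul, hg, hA]
    congr 1
    ring
  -- Two replacements are made under the integral: the propagator by t − τ, and the cube of the
  -- solution by the cube of the model.
  have hpt : ∀ τ ∈ Icc 0 t, ‖h.lowFreq (K (t - τ) (G τ))
      - (((t - τ) * (6 / 64 * A ^ 3 * g τ) : ℝ) : ℂ)‖ ≤
      2 * t ^ 2 * Ω * (4 * A) ^ 3
        + t * (3 * (4 * A) ^ 2 * (M + t * Ω * A + t ^ 2 * (4 * A) ^ 3)) := by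
    intro τ hτ
    have hτ' : τ ∈ Icc (-t) t := ⟨by linarith [hτ.1], hτ.2⟩
    have h0 : 0 ≤ t - τ := by linarith [hτ.2]
    have h0' : t - τ ≤ t := by linarith [hτ.1]
    have e : h.lowFreq (K (t - τ) (G τ)) - (((t - τ) * (6 / 64 * A ^ 3 * g τ) : ℝ) : ℂ) =
        (h.lowFreq (K (t - τ) (G τ)) - ((t - τ : ℝ) : ℂ) * h.lowFreq (G τ))
          + ((t - τ : ℝ) : ℂ) * h.lowFreq (G τ - cube (P τ)) := by
      rw [map_sub, hPg, Complex.ofReal_mul]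
      ring
    rw [e]
    refine (norm_add_le _ _).trans (add_le_add ?_ ?_)
    · refine (h.norm_lowFreq_sinOp_sub_le hm _ _).trans ?_
      have h2 : √m + 2 * Real.pi * (1 / 4) ≤ Ω := by
        rw [hΩ]
        linarith
      gcongr
      exact hGA τ
    · rw [norm_mul, Complex.norm_real, Real.norm_of_nonneg h0]
      refine mul_le_mul h0' ?_ (norm_nonneg _) ht.le
      refine (h.norm_lowFreq_le _).trans ((norm_cube_sub_le (hUA τ) (hPA τ)).trans ?_)
      gcongr
      exact hUP τ hτ'
  have hgc : Continuous g := by fun_prop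
  have hdu : ‖h.lowFreq (duhamel K G t)
      - ((6 / 64 * A ^ 3 * ∫ τ in (0 : ℝ)..t, (t - τ) * g τ : ℝ) : ℂ)‖ ≤
      (2 * t ^ 2 * Ω * (4 * A) ^ 3
        + t * (3 * (4 * A) ^ 2 * (M + t * Ω * A + t ^ 2 * (4 * A) ^ 3))) * t := by
    have e : ((6 / 64 * A ^ 3 * ∫ τ in (0 : ℝ)..t, (t - τ) * g τ : ℝ) : ℂ) =
        ∫ τ in (0 : ℝ)..t, (((t - τ) * (6 / 64 * A ^ 3 * g τ) : ℝ) : ℂ) := by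
      rw [intervalIntegral.integral_ofReal, ← intervalIntegral.integral_const_mul]
      congr 1
      refine intervalIntegral.integral_congr fun τ _ => ?_
      ring
    have hc1 : Continuous fun τ => h.lowFreq (K (t - τ) (G τ)) :=
      h.lowFreq.continuous.comp (continuous_duhamel_integrand continuous_sinOp hGc t)
    have hc2 : Continuous fun τ => (((t - τ) * (6 / 64 * A ^ 3 * g τ) : ℝ) : ℂ) := by fun_prop
    rw [map_duhamel continuous_sinOp hGc, e, ← intervalIntegral.integral_sub
      (hc1.intervalIntegrable _ _) (hc2.intervalIntegrable _ _)]
    refine (intervalIntegral.norm_integral_le_of_norm_le_const fun τ hτ => hpt τ ?_).trans_eq ?_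
    · rw [Set.uIoc_of_le ht.le] at hτ
      exact ⟨hτ.1.le, hτ.2⟩
    · rw [sub_zero, abs_of_pos ht]
  have hI := integral_sub_mul_cos_sq_mul_cos hw0 t
  have hlow : h.lowFreq (U t) =
      h.lowFreq (cosOp μ h.measurable m t F₀ + K t F₁) - h.lowFreq (duhamel K G t) := by
    rw [heq t ⟨by linarith, le_rfl⟩, map_add, map_smul, ← map_sub]
    have : cosOp μ h.measurable m t F₀ + (R : ℂ) • cosOp μ h.measurable m t (h.wave N 1 1)
        + K t F₁ - duhamel K G t = (cosOp μ h.measurable m t F₀ + K t F₁ - duhamel K G t)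
          + (R : ℂ) • cosOp μ h.measurable m t (h.wave N 1 1) := by abel
    rw [this, map_add, map_smul, h.lowFreq_cosOp_wave m t hN, smul_zero, add_zero]
  have hlin' := (h.norm_lowFreq_le _).trans (hlin t ⟨by linarith, le_rfl⟩)
  set I := ∫ τ in (0 : ℝ)..t, (t - τ) * g τ with hIdef
  have hmain : 6 / 64 * A ^ 3 * I ≤ ‖h.lowFreq (U t)‖ + M + (2 * t ^ 2 * Ω * (4 * A) ^ 3
        + t * (3 * (4 * A) ^ 2 * (M + t * Ω * A + t ^ 2 * (4 * A) ^ 3))) * t := by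
    have e : ((6 / 64 * A ^ 3 * I : ℝ) : ℂ) = -h.lowFreq (U t)
        + h.lowFreq (cosOp μ h.measurable m t F₀ + K t F₁)
        - (h.lowFreq (duhamel K G t) - ((6 / 64 * A ^ 3 * I : ℝ) : ℂ)) := by
      rw [hlow]
      ring
    have h1 : ‖((6 / 64 * A ^ 3 * I : ℝ) : ℂ)‖ ≤ ‖h.lowFreq (U t)‖ + M
        + (2 * t ^ 2 * Ω * (4 * A) ^ 3
        + t * (3 * (4 * A) ^ 2 * (M + t * Ω * A + t ^ 2 * (4 * A) ^ 3))) * t := by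
      rw [e]
      refine (norm_sub_le _ _).trans (add_le_add ((norm_add_le _ _).trans
        (add_le_add (norm_neg _).le hlin')) hdu)
    rw [Complex.norm_real] at h1
    exact (le_abs_self _).trans h1
  have hlower : 6 / 64 * A ^ 3 * (t ^ 2 / 8) ≤ 6 / 64 * A ^ 3 * I :=
    mul_le_mul_of_nonneg_left hI (by positivity)
  -- With tA = 1/1000 the main term is about 11.7 · 10⁻⁹ A and the quartic error about 3.1 · 10⁻⁹ A,
  -- which leaves more than 8 · 10⁻⁹ A. The terms in M and Ω have bounded coefficients and are
  -- absorbed in the subtracted constant.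
  have e1 : 6 / 64 * A ^ 3 * (t ^ 2 / 8) = 6 / 512 * (t * A) ^ 2 * A := by ring
  have e2 : (2 * t ^ 2 * Ω * (4 * A) ^ 3
        + t * (3 * (4 * A) ^ 2 * (M + t * Ω * A + t ^ 2 * (4 * A) ^ 3))) * t =
      128 * (t * A) ^ 3 * Ω + 48 * (t * A) ^ 2 * M + 48 * (t * A) ^ 3 * Ω
        + 3072 * (t * A) ^ 4 * A := by ring
  rw [e2, htA] at hmain
  rw [e1, htA] at hlower
  linarith

end IsFrequencySpace

end

/-! ### Weighted L² norms on the Fourier side. -/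

section

/-- The Sobolev weight `(1 + k²) ^ (s / 2)`. -/
def weight (s k : ℝ) : ℝ := (1 + k ^ 2) ^ (s / 2)

theorem weight_pos (s k : ℝ) : 0 < weight s k := Real.rpow_pos_of_pos (by positivity) _

theorem weight_le_one {s : ℝ} (hs : s ≤ 0) (k : ℝ) : weight s k ≤ 1 :=
  Real.rpow_le_one_of_one_le_of_nonpos (by nlinarith [sq_nonneg k]) (by linarith)

theorem measurable_weight (s : ℝ) : Measurable (weight s) := by
  unfold weight
  fun_prop

theorem weight_le_rpow {s k N : ℝ} (hs : s ≤ 0) (hN : 0 < N) (hk : N ≤ k) :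
    weight s k ≤ N ^ s := by
  have h1 : N ^ s = (N ^ 2) ^ (s / 2) := by
    rw [← Real.rpow_natCast, ← Real.rpow_mul hN.le]
    congr 1
    push_cast
    ring
  rw [h1]
  exact Real.rpow_le_rpow_of_nonpos (by positivity) (by nlinarith) (by linarith)

theorem weight_ge {s k : ℝ} (hs : s ≤ 0) (hk0 : 0 ≤ k) (hk : k ≤ 1) :
    (2 : ℝ) ^ (s / 2) ≤ weight s k :=
  Real.rpow_le_rpow_of_nonpos (by positivity) (by nlinarith) (by linarith)

section WeightedNorm

variable {X : Type*} [MeasurableSpace X] {μ : Measure X} {κ : X → ℝ}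

/-- The norm of `H^s` in terms of the Fourier transform `F`. -/
def weightedNorm (μ : Measure X) (κ : X → ℝ) (s : ℝ) (F : X → ℂ) : ℝ≥0∞ :=
  eLpNorm (fun ξ => (weight s (κ ξ) : ℂ) * F ξ) 2 μ

theorem weightedNorm_congr {s : ℝ} {F G : X → ℂ} (h : F =ᵐ[μ] G) :
    weightedNorm μ κ s F = weightedNorm μ κ s G := by
  refine eLpNorm_congr_ae ?_
  filter_upwards [h] with ξ hξ
  rw [hξ]

theorem measurable_weight_comp (hκ : Measurable κ) (s : ℝ) :
    Measurable fun ξ => (weight s (κ ξ) : ℂ) :=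
  Complex.measurable_ofReal.comp ((measurable_weight s).comp hκ)

theorem weightedNorm_add_le (hκ : Measurable κ) (s : ℝ) {F G : X → ℂ}
    (hF : AEStronglyMeasurable F μ) (hG : AEStronglyMeasurable G μ) :
    weightedNorm μ κ s (F + G) ≤ weightedNorm μ κ s F + weightedNorm μ κ s G := by
  have hw := (measurable_weight_comp hκ s).aestronglyMeasurable (μ := μ)
  refine le_trans (le_of_eq ?_) (eLpNorm_add_le (hw.mul hF) (hw.mul hG) one_le_two)
  refine congrArg (fun f => eLpNorm f 2 μ) (funext fun ξ => ?_)
  simp [mul_add]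

/-- The interpolation ‖F‖₂² ≤ ‖F‖_∞ ‖F‖₁. It converts L¹ estimates into H^s estimates for s ≤ 0,
given a uniform sup bound. -/
theorem eLpNorm_two_le_of_bound {F : Lp ℂ 1 μ} {D : ℝ} (hF : ∀ᵐ ξ ∂μ, ‖F ξ‖ ≤ D) :
    eLpNorm F 2 μ ≤ (ENNReal.ofReal D * ‖F‖ₑ) ^ (1 / 2 : ℝ) := by
  rw [eLpNorm_eq_lintegral_rpow_enorm_toReal two_ne_zero ENNReal.ofNat_ne_top, Lp.enorm_def,
    eLpNorm_one_eq_lintegral_enorm, ENNReal.toReal_ofNat,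
    ← lintegral_const_mul' _ _ ENNReal.ofReal_ne_top]
  refine ENNReal.rpow_le_rpow (lintegral_mono_ae ?_) (by norm_num)
  filter_upwards [hF] with ξ hξ
  rw [ENNReal.rpow_two, sq]
  refine mul_le_mul_left ?_ _
  rw [← ofReal_norm]
  exact ENNReal.ofReal_le_ofReal hξ

theorem weightedNorm_le_of_bound {s : ℝ} (hs : s ≤ 0) {F : Lp ℂ 1 μ} {D : ℝ}
    (hF : ∀ᵐ ξ ∂μ, ‖F ξ‖ ≤ D) :
    weightedNorm μ κ s F ≤ (ENNReal.ofReal D * ‖F‖ₑ) ^ (1 / 2 : ℝ) := by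
  refine (eLpNorm_mono fun ξ => ?_).trans (eLpNorm_two_le_of_bound hF)
  rw [norm_mul, Complex.norm_real, Real.norm_of_nonneg (weight_pos _ _).le]
  exact mul_le_of_le_one_left (norm_nonneg _) (weight_le_one hs _)

end WeightedNorm

section Approximation

variable {X : Type*} [AddCommGroup X] [MeasurableSpace X] [MeasurableNeg X] {μ : Measure X}
  [μ.IsNegInvariant] {κ : X → ℝ} {θ : X}

/-- Truncation to bounded frequencies and bounded values approximates in `H^s`. -/
theorem IsFrequencySpace.exists_approximation (h : IsFrequencySpace μ κ θ) {s : ℝ} {H : X → ℂ}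
    (hH : Measurable H) (hherm : ∀ᵐ ξ ∂μ, H (-ξ) = conj (H ξ)) (hfin : weightedNorm μ κ s H < ⊤)
    {ε : ℝ≥0∞} (hε : 0 < ε) :
    ∃ (D : ℝ) (F : Lp ℂ 1 μ), 0 ≤ D ∧ F ∈ admissible μ D ∧ weightedNorm μ κ s (F - H) < ε := by
  -- The first cut-off gives finite measure, and together with the second it makes the truncation
  -- integrable and bounded.
  set S : ℕ → Set X := fun n => {ξ | κ ξ ≤ n} ∩ {ξ | ‖H ξ‖ ≤ n} with hS
  have hSm : ∀ n, MeasurableSet (S n) := fun n =>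
    (measurableSet_le h.measurable measurable_const).inter
      (measurableSet_le hH.norm measurable_const)
  have hSf : ∀ n, μ (S n) < ⊤ := fun n =>
    (measure_mono inter_subset_left).trans_lt (h.measure_ball_lt_top n)
  have hFi : ∀ n, Integrable ((S n).indicator H) μ := fun n => by
    rw [integrable_indicator_iff (hSm n)]
    exact IntegrableOn.of_bound (hSf n) hH.aestronglyMeasurable n
      ((ae_restrict_iff' (hSm n)).2 (Eventually.of_forall fun ξ hξ => hξ.2))
  have hlim : Tendsto (fun n => ∫⁻ ξ, ‖((S n)ᶜ).indicator
      (fun ξ => (weight s (κ ξ) : ℂ) * H ξ) ξ‖ₑ ^ (2 : ℝ) ∂μ) atTop (𝓝 0) := by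
    have hwm : Measurable fun ξ => (weight s (κ ξ) : ℂ) * H ξ :=
      (measurable_weight_comp h.measurable s).mul hH
    have := tendsto_lintegral_of_dominated_convergence (μ := μ)
      (F := fun n ξ => ‖((S n)ᶜ).indicator (fun ξ => (weight s (κ ξ) : ℂ) * H ξ) ξ‖ₑ ^ (2 : ℝ))
      (f := fun _ => 0) (fun ξ => ‖(weight s (κ ξ) : ℂ) * H ξ‖ₑ ^ (2 : ℝ))
      (fun n => (hwm.indicator (hSm n).compl).enorm.pow_const _)
      (fun n => Eventually.of_forall fun ξ => by
        dsimp only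
        gcongr
        rw [enorm_indicator_eq_indicator_enorm]
        exact indicator_le_self _ _ ξ)
      (by
        have h1 := lintegral_rpow_enorm_lt_top_of_eLpNorm_lt_top two_ne_zero
          ENNReal.ofNat_ne_top hfin
        rw [ENNReal.toReal_ofNat] at h1
        exact h1.ne)
      (Eventually.of_forall fun ξ => by
        obtain ⟨n₀, hn₀⟩ := exists_nat_ge (max (κ ξ) ‖H ξ‖)
        refine tendsto_const_nhds.congr' ?_
        filter_upwards [eventually_ge_atTop n₀] with n hn
        have hle : max (κ ξ) ‖H ξ‖ ≤ n := hn₀.trans (by exact_mod_cast hn)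
        have : ξ ∉ (S n)ᶜ := fun hξ => hξ
          ⟨(le_max_left _ _).trans hle, (le_max_right _ _).trans hle⟩
        rw [indicator_of_notMem this]
        simp)
    simpa using this
  have hlim' : Tendsto (fun n => weightedNorm μ κ s ((S n).indicator H - H)) atTop (𝓝 0) := by
    have h1 := hlim.ennrpow_const (1 / 2 : ℝ)
    rw [ENNReal.zero_rpow_of_pos (by norm_num)] at h1
    refine h1.congr fun n => ?_
    rw [weightedNorm, eLpNorm_eq_lintegral_rpow_enorm_toReal two_ne_zero ENNReal.ofNat_ne_top,
      ENNReal.toReal_ofNat]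
    congr 1
    refine lintegral_congr fun ξ => ?_
    by_cases hξ : ξ ∈ S n <;> simp [hξ]
  obtain ⟨n, hn⟩ := (hlim'.eventually_lt_const hε).exists
  have hcoe := (hFi n).coeFn_toL1
  refine ⟨n, (hFi n).toL1 _, n.cast_nonneg, ⟨?_, ?_⟩, ?_⟩
  · filter_upwards [hcoe, ae_neg hcoe, hherm] with ξ h1 h2 h3
    -- Both cut-offs are even where H is Hermitian, so truncation preserves the symmetry.
    have : -ξ ∈ S n ↔ ξ ∈ S n := by
      simp only [hS, mem_inter_iff, mem_ofPred_eq, h.map_neg, h3, RCLike.norm_conj]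
    rw [h1, h2]
    by_cases hξ : ξ ∈ S n
    · rw [indicator_of_mem hξ, indicator_of_mem (this.2 hξ), h3]
    · rw [indicator_of_notMem hξ, indicator_of_notMem (fun h4 => hξ (this.1 h4)), _root_.map_zero]
  · filter_upwards [hcoe] with ξ h1
    rw [h1]
    by_cases hξ : ξ ∈ S n
    · rw [indicator_of_mem hξ]
      exact hξ.2
    · rw [indicator_of_notMem hξ, norm_zero]
      exact n.cast_nonneg
  · rw [weightedNorm_congr (hcoe.sub (ae_eq_refl H))]
    exact hn

end Approximation

namespace IsFrequencySpace

variable {X : Type*} [AddCommGroup X] [MeasurableSpace X] {μ : Measure X} {κ : X → ℝ} {θ : X}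
  (h : IsFrequencySpace μ κ θ)

/-- Cauchy–Schwarz on the ball of radius 1/4, where the Sobolev weight is bounded below. This turns
growth of the low frequency mass into growth of the H^s norm. -/
theorem exists_lowFreq_le {s : ℝ} (hs : s ≤ 0) :
    ∃ C : ℝ, 0 < C ∧ ∀ F : Lp ℂ 1 μ,
      ENNReal.ofReal ‖h.lowFreq F‖ ≤ ENNReal.ofReal C * weightedNorm μ κ s F := by
  set Q : Set X := {ξ | κ ξ ≤ 1 / 4} with hQ
  have hQm : MeasurableSet Q := measurableSet_le h.measurable measurable_const
  have hQf : μ Q < ⊤ := h.measure_ball_lt_top _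
  have hQ0 : 0 < μ Q := h.measure_ball_pos _ (by norm_num)
  set c : ℝ := (2 : ℝ) ^ (s / 2) with hc
  have hc0 : 0 < c := Real.rpow_pos_of_pos two_pos _
  refine ⟨c⁻¹ * (μ Q ^ (1 / 2 : ℝ)).toReal, mul_pos (inv_pos.2 hc0) (ENNReal.toReal_pos
    (ENNReal.rpow_pos hQ0 hQf.ne).ne' (ENNReal.rpow_ne_top_of_nonneg (by norm_num) hQf.ne)), ?_⟩
  intro F
  have hFm : AEStronglyMeasurable F (μ.restrict Q) :=
    (integrable_coe F).aestronglyMeasurable.restrict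
  calc ENNReal.ofReal ‖h.lowFreq F‖ = ‖∫ ξ, Q.indicator (fun _ => (1 : ℂ)) ξ * F ξ ∂μ‖ₑ := by
        rw [ofReal_norm, lowFreq, pairing_apply]
    _ ≤ ∫⁻ ξ, ‖Q.indicator (fun _ => (1 : ℂ)) ξ * F ξ‖ₑ ∂μ := enorm_integral_le_lintegral_enorm _
    _ = ∫⁻ ξ in Q, ‖F ξ‖ₑ ∂μ := by
        rw [← lintegral_indicator hQm]
        refine lintegral_congr fun ξ => ?_
        by_cases hξ : ξ ∈ Q <;> simp [hξ]
    _ = eLpNorm F 1 (μ.restrict Q) := eLpNorm_one_eq_lintegral_enorm.symm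
    _ ≤ eLpNorm F 2 (μ.restrict Q) * μ Q ^ (1 / 2 : ℝ) := by
        refine (eLpNorm_le_eLpNorm_mul_rpow_measure_univ one_le_two hFm).trans_eq ?_
        rw [Measure.restrict_apply_univ]
        congr 2
        norm_num
    _ ≤ (ENNReal.ofReal c⁻¹ * weightedNorm μ κ s F) * μ Q ^ (1 / 2 : ℝ) := by
        refine mul_le_mul_left ?_ _
        refine (eLpNorm_le_mul_eLpNorm_of_ae_le_mul (c := c⁻¹)
          (g := fun ξ => (weight s (κ ξ) : ℂ) * F ξ) ?_ 2).trans
          (mul_le_mul_right (eLpNorm_restrict_le _ _ _ _) _)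
        refine (ae_restrict_iff' hQm).2 (Eventually.of_forall fun ξ hξ => ?_)
        have h1 : κ ξ ≤ 1 / 4 := hξ
        have h2 := weight_ge hs (h.nonneg ξ) (h1.trans (by norm_num))
        rw [norm_mul, Complex.norm_real, Real.norm_of_nonneg (weight_pos _ _).le, ← mul_assoc]
        refine le_mul_of_one_le_left (norm_nonneg _) ?_
        rw [inv_mul_eq_div, one_le_div hc0]
        exact h2
    _ = ENNReal.ofReal (c⁻¹ * (μ Q ^ (1 / 2 : ℝ)).toReal) * weightedNorm μ κ s F := by
        rw [ENNReal.ofReal_mul (inv_pos.2 hc0).le, ENNReal.ofReal_toReal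
          (ENNReal.rpow_ne_top_of_nonneg (by norm_num) hQf.ne)]
        ring

variable [MeasurableAdd₂ X] [μ.IsAddLeftInvariant]

theorem coe_wave (N : ℕ) : h.wave N 1 1 =ᵐ[μ] fun ξ =>
    ∑ i : Fin 4, (bumpSet κ θ (N * ![1, -1, 2, -2] i)).indicator (fun _ => (1 : ℂ)) ξ := by
  have h1 : h.wave N 1 1 = h.bump (N * 1) + h.bump (N * -1) + h.bump (N * 2) + h.bump (N * -2) := by
    rw [wave, Fin.sum_univ_four]
    simp only [Matrix.cons_val, Complex.ofReal_one]
    rw [one_smul, one_smul, one_smul, one_smul]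
  rw [h1]
  filter_upwards [Lp.coeFn_add (h.bump (N * 1) + h.bump (N * -1) + h.bump (N * 2))
      (h.bump (N * -2)), Lp.coeFn_add (h.bump (N * 1) + h.bump (N * -1)) (h.bump (N * 2)),
    Lp.coeFn_add (h.bump (N * 1)) (h.bump (N * -1)), h.coe_bump (N * 1), h.coe_bump (N * -1),
    h.coe_bump (N * 2), h.coe_bump (N * -2)] with ξ e1 e2 e3 e4 e5 e6 e7
  rw [e1, Pi.add_apply, e2, Pi.add_apply, e3, Pi.add_apply, e4, e5, e6, e7, Fin.sum_univ_four]
  rfl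

theorem wave_mem_admissible [MeasurableNeg X] [μ.IsNegInvariant] (N : ℕ) :
    h.wave N 1 1 ∈ admissible μ 4 := by
  constructor
  · filter_upwards [h.coe_wave N, ae_neg (h.coe_wave N)] with ξ h1 h2
    have e : ∀ k : ℤ, (bumpSet κ θ k).indicator (fun _ => (1 : ℂ)) (-ξ) =
        (bumpSet κ θ (-k)).indicator (fun _ => (1 : ℂ)) ξ := fun k => by
      by_cases hξ : -ξ ∈ bumpSet κ θ k
      · rw [indicator_of_mem hξ, indicator_of_mem (h.neg_mem_bumpSet.1 hξ)]
      · rw [indicator_of_notMem hξ, indicator_of_notMem (fun h3 => hξ (h.neg_mem_bumpSet.2 h3))]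
    have e' : ∀ k : ℤ, conj ((bumpSet κ θ k).indicator (fun _ => (1 : ℂ)) ξ) =
        (bumpSet κ θ k).indicator (fun _ => (1 : ℂ)) ξ := fun k => by
      by_cases hξ : ξ ∈ bumpSet κ θ k <;> simp [hξ]
    rw [h1, h2, map_sum]
    simp only [e, e', Fin.sum_univ_four]
    simp only [Matrix.cons_val, mul_neg, neg_neg]
    ring
  · filter_upwards [h.coe_wave N] with ξ h1
    rw [h1]
    refine (norm_sum_le_of_le _ fun i _ => norm_indicator_one_le _ ξ).trans_eq (by simp)

/-- On every bump the frequency is at least N − 1/12 ≥ N/2, which yields the decay N^s. -/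
theorem weightedNorm_wave_le {s : ℝ} (hs : s ≤ 0) [MeasurableNeg X] [μ.IsNegInvariant] {N : ℕ}
    (hN : N ≠ 0) (R : ℝ) :
    weightedNorm μ κ s ((R : ℂ) • h.wave N 1 1 : Lp ℂ 1 μ) ≤
      ENNReal.ofReal (|R| * ((N : ℝ) / 2) ^ s) *
        (ENNReal.ofReal 4 * ‖h.wave N 1 1‖ₑ) ^ (1 / 2 : ℝ) := by
  refine le_trans ?_ (mul_le_mul_right (eLpNorm_two_le_of_bound (h.wave_mem_admissible N).2) _)
  refine eLpNorm_le_mul_eLpNorm_of_ae_le_mul ?_ 2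
  filter_upwards [Lp.coeFn_smul (R : ℂ) (h.wave N 1 1), h.coe_wave N] with ξ h1 h2
  rw [h1, Pi.smul_apply, smul_eq_mul, norm_mul, norm_mul, Complex.norm_real, Complex.norm_real,
    Real.norm_of_nonneg (weight_pos _ _).le, Real.norm_eq_abs, ← mul_assoc, mul_comm (weight _ _)]
  have hN1 : (1 : ℝ) ≤ N := by exact_mod_cast Nat.one_le_iff_ne_zero.2 hN
  by_cases hξ : ∃ i : Fin 4, ξ ∈ bumpSet κ θ (N * ![1, -1, 2, -2] i)
  · obtain ⟨i, hi⟩ := hξ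
    have h3 := (abs_le.1 (h.abs_sub_le hi)).1
    have h4 : (N : ℝ) ≤ |((N * ![1, -1, 2, -2] i : ℤ) : ℝ)| := by
      fin_cases i <;> simp [abs_mul] <;> linarith
    refine mul_le_mul_of_nonneg_right (mul_le_mul_of_nonneg_left ?_ (abs_nonneg R)) (norm_nonneg _)
    exact weight_le_rpow hs (by linarith) (by linarith)
  · push Not at hξ
    rw [h2, Finset.sum_eq_zero fun i _ => indicator_of_notMem (hξ i) _]
    simp

end IsFrequencySpace

end

/-! ### Norm inflation in an abstract frequency space. -/

section

variable {X M : Type*} [AddCommGroup X] [MeasurableSpace X] [MeasurableNeg X]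
  {μ : Measure X} [μ.IsNegInvariant] [TopologicalSpace M] [FirstCountableTopology M]
  {e : X → M → ℂ} {κ : X → ℝ} {θ : X}

/-- Continuity in L¹ and the uniform sup bound give continuity in L² by interpolation, and the
weight is at most 1. -/
theorem continuousInNorm_synth (he : IsCharacterFamily e) {s : ℝ} (hs : s ≤ 0)
    {N : (M →ᵇ ℝ) → ℝ≥0∞}
    (hN : ∀ D, ∀ F ∈ admissible μ D, N (synth he F) = weightedNorm μ κ s F) {D T : ℝ}
    {U : ℝ → Lp ℂ 1 μ} (hU : Continuous U) (hUD : ∀ t, U t ∈ admissible μ D) :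
    ContinuousInNorm N T fun t => synth he (U t) := by
  refine fun t _ => ⟨?_, ?_⟩
  · rw [hN D _ (hUD t)]
    refine (weightedNorm_le_of_bound hs (hUD t).2).trans_lt ?_
    exact (ENNReal.rpow_ne_top_of_nonneg (by norm_num)
      (ENNReal.mul_ne_top ENNReal.ofReal_ne_top enorm_ne_top)).lt_top
  · have hlim : Tendsto (fun τ => (ENNReal.ofReal (D + D) * ‖U τ - U t‖ₑ) ^ (1 / 2 : ℝ)) (𝓝 t)
        (𝓝 0) := by
      have h1 : Tendsto (fun τ => ‖U τ - U t‖ₑ) (𝓝 t) (𝓝 0) := by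
        have : Continuous fun τ => ‖U τ - U t‖ₑ := (hU.sub continuous_const).enorm
        simpa using this.tendsto t
      have h2 := (ENNReal.Tendsto.const_mul h1
        (Or.inr (ENNReal.ofReal_ne_top (r := D + D)))).ennrpow_const (1 / 2 : ℝ)
      rwa [mul_zero, ENNReal.zero_rpow_of_pos (by norm_num)] at h2
    refine tendsto_of_tendsto_of_tendsto_of_le_of_le tendsto_const_nhds
      (hlim.mono_left nhdsWithin_le_nhds) (fun _ => bot_le) fun τ => ?_
    have hadm := sub_mem_admissible (hUD τ) (hUD t)
    dsimp only
    rw [synth_sub, hN _ _ hadm]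
    exact weightedNorm_le_of_bound hs hadm.2

variable [MeasurableAdd₂ X] [μ.IsAddLeftInvariant]

theorem IsFrequencySpace.eventually_weightedNorm_wave_lt (h : IsFrequencySpace μ κ θ) {s : ℝ}
    (hs : s < 0) (R : ℝ) {ε : ℝ≥0∞} (hε : 0 < ε) :
    ∃ N : ℕ, N ≠ 0 ∧ weightedNorm μ κ s ((R : ℂ) • h.wave N 1 1 : Lp ℂ 1 μ) < ε := by
  set c : ℝ≥0∞ := (ENNReal.ofReal 4 * ENNReal.ofReal (4 * h.vol)) ^ (1 / 2 : ℝ) with hc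
  have hct : c ≠ ⊤ := ENNReal.rpow_ne_top_of_nonneg (by norm_num)
    (ENNReal.mul_ne_top ENNReal.ofReal_ne_top ENNReal.ofReal_ne_top)
  have h1 : Tendsto (fun N : ℕ => |R| * ((N : ℝ) / 2) ^ s) atTop (𝓝 (|R| * 0)) := by
    refine Tendsto.const_mul _ ?_
    have := (tendsto_rpow_neg_atTop (neg_pos.2 hs)).comp
      ((tendsto_natCast_atTop_atTop (R := ℝ)).atTop_div_const two_pos)
    simpa [Function.comp_def] using this
  rw [mul_zero] at h1
  have h2 : Tendsto (fun N : ℕ => ENNReal.ofReal (|R| * ((N : ℝ) / 2) ^ s) * c) atTop (𝓝 0) := by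
    have := ENNReal.Tendsto.mul_const (ENNReal.tendsto_ofReal h1) (b := c) (Or.inr hct)
    simpa using this
  obtain ⟨N, hN, hN0⟩ := ((h2.eventually_lt_const hε).and (eventually_ne_atTop 0)).exists
  refine ⟨N, hN0, ((h.weightedNorm_wave_le hs.le hN0 R).trans ?_).trans_lt hN⟩
  refine mul_le_mul_right (ENNReal.rpow_le_rpow (mul_le_mul_right ?_ _) (by norm_num)) _
  rw [← ofReal_norm]
  exact ENNReal.ofReal_le_ofReal (h.norm_wave_le N (by simp) (by simp))

variable [SFinite μ]

/-- Norm inflation at general data, on the Fourier side. -/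
theorem exists_norm_inflation (he : IsCharacterFamily e) (h : IsFrequencySpace μ κ θ) {m s : ℝ}
    (hm : 0 ≤ m) (hs : s < 0) {H₀ H₁ : X → ℂ} (hH₀ : Measurable H₀) (hH₁ : Measurable H₁)
    (hherm₀ : ∀ᵐ ξ ∂μ, H₀ (-ξ) = conj (H₀ ξ)) (hherm₁ : ∀ᵐ ξ ∂μ, H₁ (-ξ) = conj (H₁ ξ))
    (hfin₀ : weightedNorm μ κ s H₀ < ⊤) (hfin₁ : weightedNorm μ κ (s - 1) H₁ < ⊤)
    {ε : ℝ} (hε : 0 < ε) :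
    ∃ (t D : ℝ) (V₀ V₁ : Lp ℂ 1 μ) (U : ℝ → Lp ℂ 1 μ), 0 < t ∧ t < ε ∧
      V₀ ∈ admissible μ D ∧ V₁ ∈ admissible μ D ∧ (∀ τ, U τ ∈ admissible μ D) ∧ Continuous U ∧
      IsNLWSolution μ e κ m t (synth he V₀) (synth he V₁) (fun τ => synth he (U τ)) ∧
      weightedNorm μ κ s (V₀ - H₀) + weightedNorm μ κ (s - 1) (V₁ - H₁) < ENNReal.ofReal ε ∧
      ENNReal.ofReal ε⁻¹ < weightedNorm μ κ s (U t) := by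
  have hε3 : 0 < ENNReal.ofReal (ε / 3) := ENNReal.ofReal_pos.2 (by positivity)
  obtain ⟨D₀, F₀, hD₀, hF₀, hF₀H⟩ := h.exists_approximation hH₀ hherm₀ hfin₀ hε3
  obtain ⟨D₁, F₁, hD₁, hF₁, hF₁H⟩ := h.exists_approximation hH₁ hherm₁ hfin₁ hε3
  obtain ⟨C, hC, hlow⟩ := h.exists_lowFreq_le hs.le
  set L := ‖F₀‖ + ‖F₁‖ with hL
  -- A dominates the bounded part of the data, makes t < ε, and makes 8 · 10⁻⁹ A outweigh both the
  -- error constant and the target C/ε.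
  obtain ⟨A, hA⟩ := exists_gt (max (max 1 L) (max ε⁻¹ (10 ^ 9 * (C * ε⁻¹ + (2 * L + (√m + 2))))))
  simp only [max_lt_iff] at hA
  obtain ⟨⟨hA1, hAL⟩, hAε, hAbig⟩ := hA
  have hA0 : 0 < A := by linarith
  have hv := h.vol_pos
  set R : ℝ := A / (4 * h.vol) with hR
  have hR0 : 0 < R := by positivity
  have hAR : A = 4 * (R * h.vol) := by
    rw [hR]
    field_simp
  -- N is taken large only after A and R are fixed; neither the existence time nor the lower bound
  -- depends on it.
  obtain ⟨N, hN0, hN⟩ := h.eventually_weightedNorm_wave_lt hs R hε3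
  set t : ℝ := 1 / (1000 * A) with ht
  have ht0 : 0 < t := by positivity
  have htA : t * A = 1 / 1000 := by
    rw [ht]
    field_simp
  have ht1 : t ≤ 1 := by nlinarith
  have htε : t < ε := by
    have h1 : A⁻¹ < ε := inv_lt_of_inv_lt₀ hε hAε
    have h2 : t = A⁻¹ / 1000 := by
      rw [ht]
      field_simp
    have h3 : 0 < A⁻¹ := inv_pos.2 hA0
    linarith
  set Φ : Lp ℂ 1 μ := (R : ℂ) • h.wave N 1 1 with hΦ
  have hΦA : ‖Φ‖ ≤ A := by
    rw [hΦ, norm_smul, Complex.norm_real, Real.norm_of_nonneg hR0.le, hAR]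
    refine (mul_le_mul_of_nonneg_left (h.norm_wave_le N (by simp) (by simp)) hR0.le).trans_eq ?_
    ring
  have hΦadm : Φ ∈ admissible μ (|R| * 4) := by
    rw [hΦ, Complex.coe_smul]
    exact smul_mem_admissible (h.wave_mem_admissible N) R
  set D : ℝ := D₀ + |R| * 4 + D₁ with hD
  have hRn : 0 ≤ |R| * 4 := by positivity
  have hD0 : 0 ≤ D := by positivity
  have hV₀ : F₀ + Φ ∈ admissible μ D :=
    admissible_mono (by linarith) (add_mem_admissible hF₀ hΦadm)
  have hV₁ : F₁ ∈ admissible μ D := admissible_mono (by linarith) hF₁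
  -- The solution is then bounded by twice this value, the 4A required by the lower bound.
  have hB : ‖F₀ + Φ‖ + ‖F₁‖ ≤ 2 * A := by
    have := norm_add_le F₀ Φ
    linarith
  have hTB : 24 * t ^ 2 * (2 * A) ^ 2 ≤ 1 := by
    have : 24 * t ^ 2 * (2 * A) ^ 2 = 96 * (t * A) ^ 2 := by ring
    rw [this, htA]
    norm_num
  obtain ⟨U, hU, hUm, hUeq⟩ := exists_fourier_solution (hκ := h.measurable) (m := m) h.map_neg ht0
    ht1 hV₀ hV₁ hD0 hB hTB
  have hD3 : D ≤ 3 * D := by linarith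
  refine ⟨t, 3 * D, F₀ + Φ, F₁, U, ht0, htε, admissible_mono hD3 hV₀, admissible_mono hD3 hV₁,
    fun τ => (hUm τ).1, hU, isNLWSolution_synth he hV₀.1 hV₁.1 hU (fun τ => (hUm τ).1.1) hUeq,
    ?_, ?_⟩
  · have e1 : ((F₀ + Φ : Lp ℂ 1 μ) : X → ℂ) - H₀ =ᵐ[μ] (F₀ - H₀) + Φ := by
      filter_upwards [Lp.coeFn_add F₀ Φ] with ξ h1
      simp only [Pi.sub_apply, Pi.add_apply, h1]
      ring
    have h1 : weightedNorm μ κ s ((F₀ + Φ : Lp ℂ 1 μ) - H₀) ≤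
        weightedNorm μ κ s (F₀ - H₀) + weightedNorm μ κ s Φ := by
      rw [weightedNorm_congr e1]
      exact weightedNorm_add_le h.measurable s
        ((integrable_coe F₀).aestronglyMeasurable.sub hH₀.aestronglyMeasurable)
        (integrable_coe Φ).aestronglyMeasurable
    have h2 : ENNReal.ofReal ε =
        ENNReal.ofReal (ε / 3) + ENNReal.ofReal (ε / 3) + ENNReal.ofReal (ε / 3) := by
      rw [← ENNReal.ofReal_add (by positivity) (by positivity),
        ← ENNReal.ofReal_add (by positivity) (by positivity)]
      congr 1
      ring
    rw [h2]
    exact ENNReal.add_lt_add (h1.trans_lt (ENNReal.add_lt_add hF₀H hN)) hF₁H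
  · have h1 := h.norm_lowFreq_solution_ge hm hN0 hAR hA0 ht0 ht1 htA hU
      (fun τ => ((hUm τ).2).trans_eq (by ring)) hUeq
    have h2 : C * ε⁻¹ < ‖h.lowFreq (U t)‖ := by linarith
    have h3 : ENNReal.ofReal (C * ε⁻¹) < ENNReal.ofReal ‖h.lowFreq (U t)‖ :=
      (ENNReal.ofReal_lt_ofReal_iff_of_nonneg (by positivity)).2 h2
    have h4 := h3.trans_le (hlow (U t))
    rw [ENNReal.ofReal_mul hC.le] at h4
    exact lt_of_mul_lt_mul_left' h4

end

/-! ### The torus. -/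

section

section Torus

variable {d : ℕ}

theorem norm_mFourier_apply (n : Fin d → ℤ) (x : UnitAddTorus (Fin d)) :
    ‖UnitAddTorus.mFourier n x‖ = 1 := by
  rw [UnitAddTorus.mFourier, ContinuousMap.coe_mk, norm_prod]
  exact Finset.prod_eq_one fun i _ => by rw [fourier_apply, Circle.norm_coe]

theorem isCharacterFamily_torus :
    IsCharacterFamily fun (n : Fin d → ℤ) (x : UnitAddTorus (Fin d)) =>
      UnitAddTorus.mFourier n x where
  measurable _ := Measurable.of_discrete
  continuous n := (UnitAddTorus.mFourier n).continuous
  norm_eq_one := norm_mFourier_apply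
  map_add _ _ _ := UnitAddTorus.mFourier_add
  map_neg _ _ := UnitAddTorus.mFourier_neg

theorem latticeLength_eq (n : Fin d → ℤ) :
    latticeLength n = ‖WithLp.toLp 2 (fun i => (n i : ℝ))‖ := by
  simp [latticeLength, EuclideanSpace.norm_eq]

theorem isFrequencySpace_torus (i : Fin d) :
    IsFrequencySpace (Measure.count : Measure (Fin d → ℤ)) latticeLength (Pi.single i 1) where
  measurable := Measurable.of_discrete
  nonneg n := Real.sqrt_nonneg _
  map_neg n := by simp [latticeLength]
  map_add_le n k := by
    rw [latticeLength_eq, latticeLength_eq, latticeLength_eq]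
    refine le_trans (le_of_eq ?_) (norm_add_le _ _)
    congr 1
    ext j
    simp
  map_zsmul k := by
    rw [latticeLength, Finset.sum_eq_single i (fun j _ hj => by simp [hj]) (by simp)]
    simp [Real.sqrt_sq_eq_abs]
  measure_ball_lt_top r := by
    refine Measure.count_apply_lt_top.2 ?_
    refine (Set.finite_Icc (fun _ : Fin d => -⌈r⌉) (fun _ => ⌈r⌉)).subset fun n hn => ?_
    have h1 : ∀ j, |(n j : ℝ)| ≤ r := fun j => by
      refine le_trans ?_ hn
      rw [latticeLength, ← Real.sqrt_sq_eq_abs]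
      exact Real.sqrt_le_sqrt (Finset.single_le_sum (f := fun i => (n i : ℝ) ^ 2)
        (fun i _ => sq_nonneg _) (Finset.mem_univ j))
    have h2 : ∀ j, |n j| ≤ ⌈r⌉ := fun j => by
      have := (h1 j).trans (Int.le_ceil r)
      exact_mod_cast this
    exact ⟨fun j => (abs_le.1 (h2 j)).1, fun j => (abs_le.1 (h2 j)).2⟩
  measure_ball_pos r hr := by
    refine pos_iff_ne_zero.2 fun h0 => ?_
    rw [Measure.count_eq_zero_iff] at h0
    have : (0 : Fin d → ℤ) ∈ {n : Fin d → ℤ | latticeLength n ≤ r} := by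
      simp [latticeLength, hr.le]
    rw [h0] at this
    exact this

/-- The Haar probability measure of the torus. -/
def haarTorus (d : ℕ) : Measure (UnitAddTorus (Fin d)) :=
  Measure.pi fun _ => AddCircle.haarAddCircle

instance : IsProbabilityMeasure (haarTorus d) :=
  inferInstanceAs (IsProbabilityMeasure (Measure.pi fun _ : Fin d => AddCircle.haarAddCircle))

theorem integral_mFourier_neg_mul (n k : Fin d → ℤ) :
    ∫ x, UnitAddTorus.mFourier (-n) x * UnitAddTorus.mFourier k x ∂haarTorus d =
      if n = k then 1 else 0 := by
  have h := orthonormal_iff_ite.1 (UnitAddTorus.orthonormal_mFourier (d := Fin d)) n k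
  rw [UnitAddTorus.mFourierLp, UnitAddTorus.mFourierLp, ContinuousMap.inner_toLp] at h
  rw [← h]
  change _ = ∫ x, _ ∂haarTorus d
  congr 1
  funext x
  rw [UnitAddTorus.mFourier_neg, mul_comm]

/-- Absolute summability allows Fubini, after which orthonormality of the characters selects one
coefficient. -/
theorem torusCoeff_synth {F : Lp ℂ 1 (Measure.count : Measure (Fin d → ℤ))}
    (hF : IsHermitian F) (n : Fin d → ℤ) :
    torusCoeff (synth isCharacterFamily_torus F) n = F n := by
  have hi : Integrable (fun p : UnitAddTorus (Fin d) × (Fin d → ℤ) =>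
      UnitAddTorus.mFourier (-n) p.1 * (F p.2 * UnitAddTorus.mFourier p.2 p.1))
      ((haarTorus d).prod Measure.count) := by
    have h1 : Integrable (fun p : UnitAddTorus (Fin d) × (Fin d → ℤ) => F p.2)
        ((haarTorus d).prod Measure.count) :=
      (integrable_coe F).comp_snd _
    have h2 : Measurable fun p : UnitAddTorus (Fin d) × (Fin d → ℤ) =>
        UnitAddTorus.mFourier (-n) p.1 * UnitAddTorus.mFourier p.2 p.1 :=
      measurable_from_prod_countable_left fun k =>
        ((UnitAddTorus.mFourier (-n)).continuous.mul
          (UnitAddTorus.mFourier k).continuous).measurable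
    refine (h1.bdd_mul (c := 1) h2.aestronglyMeasurable (Eventually.of_forall fun p => ?_)).congr
      (Eventually.of_forall fun p => ?_)
    · rw [norm_mul, norm_mFourier_apply, norm_mFourier_apply, mul_one]
    · dsimp only
      ring
  calc torusCoeff (synth isCharacterFamily_torus F) n
      = ∫ x, ∫ k, UnitAddTorus.mFourier (-n) x * (F k * UnitAddTorus.mFourier k x)
          ∂Measure.count ∂haarTorus d := by
        rw [torusCoeff, UnitAddTorus.mFourierCoeff]
        change ∫ x, _ ∂haarTorus d = _
        congr 1
        funext x
        rw [hF.coe_synth isCharacterFamily_torus, evalAt_apply, smul_eq_mul, integral_const_mul]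
    _ = ∫ k, F k * (if n = k then 1 else 0) ∂Measure.count := by
        rw [integral_integral_swap hi]
        congr 1
        funext k
        rw [← integral_mFourier_neg_mul, ← integral_const_mul]
        congr 1
        funext x
        ring
    _ = ∫ k in {n}, F k ∂Measure.count := by
        rw [← integral_indicator (measurableSet_singleton n)]
        congr 1
        funext k
        by_cases h : n = k
        · simp [h]
        · simp [h, Ne.symm h]
    _ = F n := by simp

theorem torusSobolevNorm_eq (s : ℝ) (c : (Fin d → ℤ) → ℂ) :
    torusSobolevNorm s c = weightedNorm Measure.count latticeLength s c := by
  rw [torusSobolevNorm, weightedNorm, eLpNorm_eq_lintegral_rpow_enorm_toReal two_ne_zero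
    ENNReal.ofNat_ne_top, ENNReal.toReal_ofNat, lintegral_count]
  congr 1
  refine tsum_congr fun n => ?_
  rw [← ofReal_norm, ENNReal.rpow_two, ← ENNReal.ofReal_pow (norm_nonneg _), norm_mul, mul_pow,
    Complex.norm_real, Real.norm_of_nonneg (weight_pos _ _).le]
  congr 2
  rw [weight, sq (_ ^ (s / 2)), ← Real.rpow_add (by positivity), add_halves]

theorem torus_coeff_neg {f : TorusDistribution d} (hf : f.IsReal) (n : Fin d → ℤ) :
    f.coeff (-n) = conj (f.coeff n) :=
  hf _ _ fun x => by
    change UnitAddTorus.mFourier (- -n) x = conj (UnitAddTorus.mFourier (-n) x)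
    rw [UnitAddTorus.mFourier_neg (n := -n)]

theorem torus_norm_inflation {m s : ℝ} (hm : 0 ≤ m) (hd : 0 < d) (hs : s < 0)
    {u₀ u₁ : TorusDistribution d} (hu₀ : u₀.IsReal) (hu₁ : u₁.IsReal)
    (hfin₀ : torusSobolevNorm s u₀.coeff < ⊤) (hfin₁ : torusSobolevNorm (s - 1) u₁.coeff < ⊤)
    {ε : ℝ} (hε : 0 < ε) :
    ∃ (T t : ℝ) (v₀ v₁ : UnitAddTorus (Fin d) →ᵇ ℝ) (u : ℝ → UnitAddTorus (Fin d) →ᵇ ℝ),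
      0 < t ∧ t < ε ∧ t ≤ T ∧ IsTorusNLWSolution d m T v₀ v₁ u ∧
      ContinuousInNorm (fun f => torusSobolevNorm s (torusCoeff f)) T u ∧
      torusSobolevNorm s (torusCoeff v₀ - u₀.coeff)
        + torusSobolevNorm (s - 1) (torusCoeff v₁ - u₁.coeff) < ENNReal.ofReal ε ∧
      ENNReal.ofReal ε⁻¹ < torusSobolevNorm s (torusCoeff (u t)) := by
  rw [torusSobolevNorm_eq] at hfin₀ hfin₁
  obtain ⟨t, D, V₀, V₁, U, ht0, htε, hV₀, hV₁, hUD, hU, hsol, hdist, hbig⟩ :=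
    exists_norm_inflation isCharacterFamily_torus (isFrequencySpace_torus ⟨0, hd⟩) hm hs
      Measurable.of_discrete Measurable.of_discrete
      (Eventually.of_forall (torus_coeff_neg hu₀)) (Eventually.of_forall (torus_coeff_neg hu₁))
      hfin₀ hfin₁ hε
  have hcoeff : ∀ {F : Lp ℂ 1 (Measure.count : Measure (Fin d → ℤ))}, IsHermitian F →
      torusCoeff (synth isCharacterFamily_torus F) = F := fun hF => funext (torusCoeff_synth hF)
  refine ⟨t, t, _, _, _, ht0, htε, le_rfl, hsol, continuousInNorm_synth (κ := latticeLength) _ hs.le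
    (fun D F hF => ?_) hU hUD, ?_, ?_⟩
  · rw [hcoeff hF.1, torusSobolevNorm_eq]
  · rw [hcoeff hV₀.1, hcoeff hV₁.1, torusSobolevNorm_eq, torusSobolevNorm_eq]
    exact hdist
  · rw [hcoeff (hUD t).1, torusSobolevNorm_eq]
    exact hbig

end Torus

end

/-! ### The Euclidean space. -/

section

section Euclid

open FourierTransform

variable {d : ℕ}

theorem isCharacterFamily_euclid : IsCharacterFamily (euclideanChar d) where
  measurable x := by
    unfold euclideanChar
    exact (Real.continuous_fourierChar.comp
      (continuous_id.inner continuous_const)).subtype_val.measurable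
  continuous ξ := by
    unfold euclideanChar
    exact (Real.continuous_fourierChar.comp
      (continuous_const.inner continuous_id)).subtype_val
  norm_eq_one ξ x := Circle.norm_coe _
  map_add ξ η x := by
    rw [euclideanChar, inner_add_left, AddChar.map_add_eq_mul, Circle.coe_mul]
    rfl
  map_neg ξ x := by
    rw [euclideanChar, inner_neg_left, AddChar.map_neg_eq_inv, Circle.coe_inv_eq_conj]
    rfl

theorem isFrequencySpace_euclid (i : Fin d) :
    IsFrequencySpace (volume : Measure (EuclideanSpace ℝ (Fin d))) (fun ξ => ‖ξ‖)
      (EuclideanSpace.single i 1) where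
  measurable := measurable_norm
  nonneg := norm_nonneg
  map_neg := norm_neg
  map_add_le := norm_add_le
  map_zsmul k := by
    rw [← Int.cast_smul_eq_zsmul ℝ, norm_smul, PiLp.norm_single, norm_one, mul_one,
      Real.norm_eq_abs]
  measure_ball_lt_top r := by
    have : {ξ : EuclideanSpace ℝ (Fin d) | ‖ξ‖ ≤ r} = Metric.closedBall 0 r := by
      ext ξ
      simp
    rw [this]
    exact measure_closedBall_lt_top
  measure_ball_pos r hr := by
    have : {ξ : EuclideanSpace ℝ (Fin d) | ‖ξ‖ ≤ r} = Metric.closedBall 0 r := by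
      ext ξ
      simp
    rw [this]
    exact Metric.measure_closedBall_pos _ _ hr

/-- The multiplication of tempered distributions by `(1 + |ξ|²)^(s/2)`. -/
def weightCLM (d : ℕ) (s : ℝ) :
    𝓢'(EuclideanSpace ℝ (Fin d), ℂ) →L[ℂ] 𝓢'(EuclideanSpace ℝ (Fin d), ℂ) :=
  TemperedDistribution.smulLeftCLM ℂ
    (fun ξ => ((weight s ‖ξ‖ : ℝ) : ℂ))

theorem hasTemperateGrowth_weight (s : ℝ) :
    (fun ξ : EuclideanSpace ℝ (Fin d) => ((weight s ‖ξ‖ : ℝ) : ℂ)).HasTemperateGrowth := by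
  unfold weight
  fun_prop

theorem fourier_besselPotential (s : ℝ) (f : 𝓢'(EuclideanSpace ℝ (Fin d), ℂ)) :
    𝓕 (TemperedDistribution.besselPotential _ ℂ s f) = weightCLM d s (𝓕 f) :=
  TemperedDistribution.fourier_besselPotential_eq_smulLeftCLM_fourier_apply s f

theorem weightCLM_fourier_apply (s : ℝ) (f : 𝓢'(EuclideanSpace ℝ (Fin d), ℂ))
    (φ : 𝓢(EuclideanSpace ℝ (Fin d), ℂ)) :
    weightCLM d s (𝓕 f) φ = f (𝓕 (SchwartzMap.smulLeftCLM ℂ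
      (fun ξ : EuclideanSpace ℝ (Fin d) => ((weight s ‖ξ‖ : ℝ) : ℂ)) φ)) :=
  rfl

/-- The distribution `f` belongs to `H^s(ℝ^d)` and its Fourier transform is the function `H`. -/
def HasSobolevTransform (s : ℝ) (f : 𝓢'(EuclideanSpace ℝ (Fin d), ℂ))
    (H : EuclideanSpace ℝ (Fin d) → ℂ) : Prop :=
  ∃ g : Lp ℂ 2 (volume : Measure (EuclideanSpace ℝ (Fin d))),
    g =ᵐ[volume] (fun ξ => (weight s ‖ξ‖ : ℂ) * H ξ) ∧ weightCLM d s (𝓕 f) = g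

theorem HasSobolevTransform.sub {s : ℝ} {f f' : 𝓢'(EuclideanSpace ℝ (Fin d), ℂ)}
    {H H' : EuclideanSpace ℝ (Fin d) → ℂ} (h : HasSobolevTransform s f H)
    (h' : HasSobolevTransform s f' H') : HasSobolevTransform s (f - f') (H - H') := by
  obtain ⟨g, hg, hfg⟩ := h
  obtain ⟨g', hg', hfg'⟩ := h'
  refine ⟨g - g', ?_, ?_⟩
  · filter_upwards [Lp.coeFn_sub g g', hg, hg'] with ξ h1 h2 h3
    rw [h1, Pi.sub_apply, Pi.sub_apply, h2, h3, mul_sub]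
  · rw [sub_eq_add_neg, FourierTransform.fourier_add, FourierTransform.fourier_neg,
      ← sub_eq_add_neg, map_sub, hfg, hfg', ← Lp.toTemperedDistributionCLM_apply,
      ← Lp.toTemperedDistributionCLM_apply, ← Lp.toTemperedDistributionCLM_apply, map_sub]

theorem injective_toTemperedDistribution :
    Function.Injective (Lp.toTemperedDistribution :
      Lp ℂ 2 (volume : Measure (EuclideanSpace ℝ (Fin d))) → _) := by
  intro g g' h
  exact LinearMap.ker_eq_bot.1 (Lp.ker_toTemperedDistributionCLM_eq_bot (F := ℂ)
    (μ := (volume : Measure (EuclideanSpace ℝ (Fin d)))) (p := 2)) h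

theorem fourier_besselPotential_eq_iff (s : ℝ) (f : 𝓢'(EuclideanSpace ℝ (Fin d), ℂ))
    (g : Lp ℂ 2 (volume : Measure (EuclideanSpace ℝ (Fin d)))) :
    TemperedDistribution.besselPotential _ ℂ s f = g ↔
      weightCLM d s (𝓕 f) = (𝓕 g : Lp ℂ 2 (volume : Measure (EuclideanSpace ℝ (Fin d)))) := by
  rw [← fourier_besselPotential, ← Lp.fourier_toTemperedDistribution_eq]
  refine ⟨fun h => by rw [h], fun h => ?_⟩
  have hinv : ∀ T : 𝓢'(EuclideanSpace ℝ (Fin d), ℂ),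
      (𝓕⁻ (𝓕 T : 𝓢'(EuclideanSpace ℝ (Fin d), ℂ)) : 𝓢'(EuclideanSpace ℝ (Fin d), ℂ)) = T :=
    FourierTransform.fourierInv_fourier_eq
  rw [← hinv (TemperedDistribution.besselPotential _ ℂ s f), h, hinv]

/-- Since L² embeds injectively in the tempered distributions, the infimum defining the norm runs
over the single function whose Fourier transform is the weighted H. Plancherel identifies the norms.
-/
theorem HasSobolevTransform.norm_eq {s : ℝ} {f : 𝓢'(EuclideanSpace ℝ (Fin d), ℂ)}
    {H : EuclideanSpace ℝ (Fin d) → ℂ} (h : HasSobolevTransform s f H) :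
    euclideanSobolevNorm s f = weightedNorm volume (fun ξ => ‖ξ‖) s H := by
  obtain ⟨g, hg, hfg⟩ := h
  have hn : weightedNorm volume (fun ξ => ‖ξ‖) s H = ‖g‖ₑ := by
    rw [Lp.enorm_def]
    exact (eLpNorm_congr_ae hg).symm
  have hiff : ∀ g' : Lp ℂ 2 (volume : Measure (EuclideanSpace ℝ (Fin d))),
      TemperedDistribution.besselPotential _ ℂ s f = g' ↔ 𝓕 g' = g := fun g' => by
    rw [fourier_besselPotential_eq_iff, hfg, injective_toTemperedDistribution.eq_iff, eq_comm]
  rw [hn, euclideanSobolevNorm]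
  refine le_antisymm ?_ (le_iInf₂ fun g' hg' => ?_)
  · refine (iInf₂_le (𝓕⁻ g) ((hiff _).2 (FourierTransform.fourier_fourierInv_eq g))).trans_eq ?_
    rw [← ofReal_norm, ← ofReal_norm, ← Lp.norm_fourier_eq, FourierTransform.fourier_fourierInv_eq]
  · rw [← (hiff g').1 hg', ← ofReal_norm, ← ofReal_norm, Lp.norm_fourier_eq]

theorem HasSobolevTransform.weightedNorm_lt_top {s : ℝ} {f : 𝓢'(EuclideanSpace ℝ (Fin d), ℂ)}
    {H : EuclideanSpace ℝ (Fin d) → ℂ} (h : HasSobolevTransform s f H) :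
    weightedNorm volume (fun ξ => ‖ξ‖) s H < ⊤ := by
  obtain ⟨g, hg, -⟩ := h
  rw [weightedNorm, ← eLpNorm_congr_ae hg]
  exact Lp.eLpNorm_lt_top g

theorem exists_hasSobolevTransform {s : ℝ} {f : 𝓢'(EuclideanSpace ℝ (Fin d), ℂ)}
    (hf : TemperedDistribution.MemSobolev s 2 f) :
    ∃ H : EuclideanSpace ℝ (Fin d) → ℂ, Measurable H ∧ HasSobolevTransform s f H := by
  obtain ⟨g, hg⟩ := TemperedDistribution.memSobolev_iff_exists_smulLeftCLM_fourier.1 hf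
  refine ⟨fun ξ => ((weight s ‖ξ‖ : ℝ) : ℂ)⁻¹ * g ξ, ?_, g, Eventually.of_forall fun ξ => ?_, hg⟩
  · exact (Complex.measurable_ofReal.comp ((measurable_weight s).comp measurable_norm)).inv.mul
      (Lp.stronglyMeasurable g).measurable
  · have : ((weight s ‖ξ‖ : ℝ) : ℂ) ≠ 0 := Complex.ofReal_ne_zero.2 (weight_pos _ _).ne'
    dsimp only
    rw [mul_inv_cancel_left₀ this]

theorem fourier_comp_neg_of_real (χ χ' : 𝓢(EuclideanSpace ℝ (Fin d), ℂ))
    (hreal : ∀ ξ, conj (χ ξ) = χ ξ) (hneg : ∀ ξ, χ' ξ = χ (-ξ)) (x : EuclideanSpace ℝ (Fin d)) :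
    𝓕 χ' x = conj (𝓕 χ x) := by
  rw [SchwartzMap.fourier_coe, SchwartzMap.fourier_coe, Real.fourier_eq, Real.fourier_eq,
    ← integral_conj, ← integral_neg_eq_self]
  congr 1
  funext ξ
  rw [hneg, neg_neg, inner_neg_left, Circle.smul_def, Circle.smul_def, smul_eq_mul, smul_eq_mul,
    map_mul, hreal, ← Circle.coe_inv_eq_conj, ← AddChar.map_neg_eq_inv]

/-- Reflecting a real test function conjugates its Fourier transform. Reality of f therefore says
that g(−ξ) and the conjugate of g(ξ) have equal integrals against all real smooth compactly
supported functions. The weight is even, real and nonzero, so the symmetry passes from g to H. -/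
theorem HasSobolevTransform.ae_hermitian {s : ℝ} {f : 𝓢'(EuclideanSpace ℝ (Fin d), ℂ)}
    {H : EuclideanSpace ℝ (Fin d) → ℂ} (h : HasSobolevTransform s f H) (hf : IsRealTempered f) :
    ∀ᵐ ξ ∂volume, H (-ξ) = conj (H ξ) := by
  obtain ⟨g, hg, hfg⟩ := h
  have hmp := Measure.measurePreserving_neg (volume : Measure (EuclideanSpace ℝ (Fin d)))
  have key : ∀ᵐ ξ ∂(volume : Measure (EuclideanSpace ℝ (Fin d))), g (-ξ) = conj (g ξ) := by
    refine ae_eq_of_integral_contDiff_smul_eq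
      (((Lp.memLp g).comp_measurePreserving hmp).locallyIntegrable one_le_two)
      ((Lp.memLp g).star.locallyIntegrable one_le_two) fun η hη hηc => ?_
    have hc : HasCompactSupport (Complex.ofRealCLM ∘ η) := hηc.comp_left rfl
    have hs : ContDiff ℝ ∞ (Complex.ofRealCLM ∘ η) := by fun_prop
    set ψ : 𝓢(EuclideanSpace ℝ (Fin d), ℂ) := hc.toSchwartzMap hs with hψ
    have hψη : ∀ ξ, ψ ξ = (η ξ : ℂ) := fun ξ => rfl
    set ψ' : 𝓢(EuclideanSpace ℝ (Fin d), ℂ) := SchwartzMap.compCLMOfContinuousLinearEquiv ℂ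
      (LinearIsometryEquiv.neg ℝ (E := EuclideanSpace ℝ (Fin d))).toContinuousLinearEquiv ψ
    have hψ' : ∀ ξ, ψ' ξ = ψ (-ξ) := fun ξ => rfl
    have hw := hasTemperateGrowth_weight (d := d) s
    have h1 := hf _ _ (fourier_comp_neg_of_real
      (SchwartzMap.smulLeftCLM ℂ (fun ξ => ((weight s ‖ξ‖ : ℝ) : ℂ)) ψ)
      (SchwartzMap.smulLeftCLM ℂ (fun ξ => ((weight s ‖ξ‖ : ℝ) : ℂ)) ψ')
      (fun ξ => by
        rw [SchwartzMap.smulLeftCLM_apply_apply hw, hψη, smul_eq_mul, map_mul, Complex.conj_ofReal,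
          Complex.conj_ofReal])
      (fun ξ => by
        rw [SchwartzMap.smulLeftCLM_apply_apply hw, SchwartzMap.smulLeftCLM_apply_apply hw, hψ',
          norm_neg]))
    rw [← weightCLM_fourier_apply, ← weightCLM_fourier_apply, hfg, Lp.toTemperedDistribution_apply,
      Lp.toTemperedDistribution_apply, ← integral_conj, ← integral_neg_eq_self] at h1
    refine Eq.trans ?_ (h1.trans ?_)
    · congr 1
      funext ξ
      rw [hψ', neg_neg, hψη, smul_eq_mul, Complex.real_smul]
    · congr 1
      funext ξ
      rw [hψη, smul_eq_mul, map_mul, Complex.conj_ofReal, Complex.real_smul]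
  filter_upwards [key, hg, hmp.quasiMeasurePreserving.ae hg] with ξ h1 h2 h3
  rw [h2, h3, norm_neg, map_mul, Complex.conj_ofReal] at h1
  exact mul_left_cancel₀ (Complex.ofReal_ne_zero.2 (weight_pos _ _).ne') h1

/-- Fubini and Fourier inversion on Schwartz functions: the distributional Fourier transform of the
synthesized function is F. -/
theorem temperedOfFun_synth_fourier {F : Lp ℂ 1 (volume : Measure (EuclideanSpace ℝ (Fin d)))}
    (hF : IsHermitian F) (φ : 𝓢(EuclideanSpace ℝ (Fin d), ℂ)) :
    temperedOfFun (synth isCharacterFamily_euclid F) (𝓕 φ) = ∫ ξ, φ ξ * F ξ := by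
  have hchar : Continuous fun p : EuclideanSpace ℝ (Fin d) × EuclideanSpace ℝ (Fin d) =>
      euclideanChar d p.2 p.1 := by
    unfold euclideanChar
    exact (Real.continuous_fourierChar.comp (continuous_snd.inner continuous_fst)).subtype_val
  have hi : Integrable (fun p : EuclideanSpace ℝ (Fin d) × EuclideanSpace ℝ (Fin d) =>
      𝓕 φ p.1 * (F p.2 * euclideanChar d p.2 p.1)) (volume.prod volume) := by
    refine (((𝓕 φ).integrable.mul_prod (integrable_coe F)).bdd_mul (c := 1)
      hchar.aestronglyMeasurable (Eventually.of_forall fun p =>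
        (isCharacterFamily_euclid.norm_eq_one _ _).le)).congr (Eventually.of_forall fun p => ?_)
    dsimp only
    ring
  calc temperedOfFun (synth isCharacterFamily_euclid F) (𝓕 φ)
      = ∫ x, 𝓕 φ x * (synth isCharacterFamily_euclid F x : ℂ) := by
        rw [temperedOfFun, Lp.toTemperedDistribution_apply]
        refine integral_congr_ae ?_
        filter_upwards [(boundedContinuous_memLp_top
          (synth isCharacterFamily_euclid F)).coeFn_toLp] with x hx
        rw [hx, smul_eq_mul]
    _ = ∫ x, ∫ ξ, 𝓕 φ x * (F ξ * euclideanChar d ξ x) := by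
        congr 1
        funext x
        rw [hF.coe_synth isCharacterFamily_euclid, evalAt_apply, integral_const_mul]
    _ = ∫ ξ, 𝓕⁻ (𝓕 φ) ξ * F ξ := by
        rw [integral_integral_swap hi]
        congr 1
        funext ξ
        rw [SchwartzMap.fourierInv_coe, Real.fourierInv_eq, ← integral_mul_const]
        congr 1
        funext x
        rw [euclideanChar, Circle.smul_def, smul_eq_mul, real_inner_comm]
        ring
    _ = ∫ ξ, φ ξ * F ξ := by rw [FourierTransform.fourierInv_fourier_eq]

theorem hasSobolevTransform_synth {s D : ℝ} (hs : s ≤ 0)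
    {F : Lp ℂ 1 (volume : Measure (EuclideanSpace ℝ (Fin d)))} (hF : F ∈ admissible volume D) :
    HasSobolevTransform s (temperedOfFun (synth isCharacterFamily_euclid F)) F := by
  have hlt : weightedNorm volume (fun ξ : EuclideanSpace ℝ (Fin d) => ‖ξ‖) s F < ⊤ :=
    (weightedNorm_le_of_bound hs hF.2).trans_lt (ENNReal.rpow_ne_top_of_nonneg (by norm_num)
      (ENNReal.mul_ne_top ENNReal.ofReal_ne_top enorm_ne_top)).lt_top
  have hm : AEStronglyMeasurable (fun ξ : EuclideanSpace ℝ (Fin d) => (weight s ‖ξ‖ : ℂ) * F ξ) :=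
    (Complex.measurable_ofReal.comp
      ((measurable_weight s).comp measurable_norm)).aestronglyMeasurable.mul
      (integrable_coe F).aestronglyMeasurable
  have hL : MemLp (fun ξ : EuclideanSpace ℝ (Fin d) => (weight s ‖ξ‖ : ℂ) * F ξ) 2 volume :=
    ⟨hm, hlt⟩
  refine ⟨hL.toLp, hL.coeFn_toLp, ?_⟩
  ext φ
  rw [weightCLM_fourier_apply, temperedOfFun_synth_fourier hF.1, Lp.toTemperedDistribution_apply]
  refine integral_congr_ae ?_
  filter_upwards [hL.coeFn_toLp] with ξ h1
  rw [h1, SchwartzMap.smulLeftCLM_apply_apply (hasTemperateGrowth_weight s), smul_eq_mul,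
    smul_eq_mul]
  ring

theorem euclid_norm_inflation {m s : ℝ} (hm : 0 ≤ m) (hd : 0 < d) (hs : s < 0)
    {u₀ u₁ : 𝓢'(EuclideanSpace ℝ (Fin d), ℂ)} (hu₀ : IsRealTempered u₀) (hu₁ : IsRealTempered u₁)
    (hmem₀ : TemperedDistribution.MemSobolev s 2 u₀)
    (hmem₁ : TemperedDistribution.MemSobolev (s - 1) 2 u₁) {ε : ℝ} (hε : 0 < ε) :
    ∃ (T t : ℝ) (v₀ v₁ : EuclideanSpace ℝ (Fin d) →ᵇ ℝ)
      (u : ℝ → EuclideanSpace ℝ (Fin d) →ᵇ ℝ),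
      0 < t ∧ t < ε ∧ t ≤ T ∧ IsEuclideanNLWSolution d m T v₀ v₁ u ∧
      ContinuousInNorm (fun f => euclideanSobolevNorm s (temperedOfFun f)) T u ∧
      euclideanSobolevNorm s (temperedOfFun v₀ - u₀)
        + euclideanSobolevNorm (s - 1) (temperedOfFun v₁ - u₁) < ENNReal.ofReal ε ∧
      ENNReal.ofReal ε⁻¹ < euclideanSobolevNorm s (temperedOfFun (u t)) := by
  obtain ⟨H₀, hH₀, hT₀⟩ := exists_hasSobolevTransform hmem₀
  obtain ⟨H₁, hH₁, hT₁⟩ := exists_hasSobolevTransform hmem₁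
  obtain ⟨t, D, V₀, V₁, U, ht0, htε, hV₀, hV₁, hUD, hU, hsol, hdist, hbig⟩ :=
    exists_norm_inflation isCharacterFamily_euclid (isFrequencySpace_euclid ⟨0, hd⟩) hm hs
      hH₀ hH₁ (hT₀.ae_hermitian hu₀) (hT₁.ae_hermitian hu₁) hT₀.weightedNorm_lt_top
      hT₁.weightedNorm_lt_top hε
  have hs1 : s - 1 ≤ 0 := by linarith
  refine ⟨t, t, _, _, _, ht0, htε, le_rfl, hsol, continuousInNorm_synth (κ := fun ξ => ‖ξ‖) _ hs.le
    (fun D F hF => (hasSobolevTransform_synth hs.le hF).norm_eq) hU hUD, ?_, ?_⟩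
  · rw [((hasSobolevTransform_synth hs.le hV₀).sub hT₀).norm_eq,
      ((hasSobolevTransform_synth hs1 hV₁).sub hT₁).norm_eq]
    exact hdist
  · rw [(hasSobolevTransform_synth hs.le (hUD t)).norm_eq]
    exact hbig

end Euclid

end

end Wiener

end

theorem mainTheorem3 (d : ℕ) (m s : ℝ) (hm : 0 ≤ m)
    (hs : (d = 1 ∧ s ≤ -(1 / 2)) ∨ (2 ≤ d ∧ s < 0)) :
    (∀ u₀ u₁ : 𝓢'(EuclideanSpace ℝ (Fin d), ℂ),
      IsRealTempered u₀ → IsRealTempered u₁ →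
      TemperedDistribution.MemSobolev s 2 u₀ → TemperedDistribution.MemSobolev (s - 1) 2 u₁ →
      ∀ ε : ℝ, 0 < ε →
        ∃ (T t : ℝ) (v₀ v₁ : EuclideanSpace ℝ (Fin d) →ᵇ ℝ)
          (u : ℝ → EuclideanSpace ℝ (Fin d) →ᵇ ℝ),
          0 < t ∧ t < ε ∧ t ≤ T ∧
          IsEuclideanNLWSolution d m T v₀ v₁ u ∧
          ContinuousInNorm (fun f => euclideanSobolevNorm s (temperedOfFun f)) T u ∧
          euclideanSobolevNorm s (temperedOfFun v₀ - u₀)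
            + euclideanSobolevNorm (s - 1) (temperedOfFun v₁ - u₁) < ENNReal.ofReal ε ∧
          ENNReal.ofReal ε⁻¹ < euclideanSobolevNorm s (temperedOfFun (u t))) ∧
    (∀ u₀ u₁ : TorusDistribution d,
      u₀.IsReal → u₁.IsReal →
      torusSobolevNorm s u₀.coeff < ⊤ → torusSobolevNorm (s - 1) u₁.coeff < ⊤ →
      ∀ ε : ℝ, 0 < ε →
        ∃ (T t : ℝ) (v₀ v₁ : UnitAddTorus (Fin d) →ᵇ ℝ)
          (u : ℝ → UnitAddTorus (Fin d) →ᵇ ℝ),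
          0 < t ∧ t < ε ∧ t ≤ T ∧
          IsTorusNLWSolution d m T v₀ v₁ u ∧
          ContinuousInNorm (fun f => torusSobolevNorm s (torusCoeff f)) T u ∧
          torusSobolevNorm s (torusCoeff v₀ - u₀.coeff)
            + torusSobolevNorm (s - 1) (torusCoeff v₁ - u₁.coeff) < ENNReal.ofReal ε ∧
          ENNReal.ofReal ε⁻¹ < torusSobolevNorm s (torusCoeff (u t))) := by
  -- A positive dimension supplies the unit vector along which the bumps are placed.
  have hd : 0 < d := by omega
  have hs0 : s < 0 := by
    rcases hs with ⟨-, h⟩ | ⟨-, h⟩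
    · linarith
    · exact h
  exact ⟨fun _ _ hu₀ hu₁ hmem₀ hmem₁ _ hε =>
      Wiener.euclid_norm_inflation hm hd hs0 hu₀ hu₁ hmem₀ hmem₁ hε,
    fun _ _ hu₀ hu₁ hfin₀ hfin₁ _ hε =>
      Wiener.torus_norm_inflation hm hd hs0 hu₀ hu₁ hfin₀ hfin₁ hε⟩
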